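/- **Setting.** Let $K<M$, players $[K]$, arms $[M]$, estimates $\hat\mu_k(m)\in[0,1]$ $(k\in[K],m\in[M])$, and exponents $\kappa>M$, $0<\beta<\kappa$. At each time step an attack vector $w\in\{0,1\}^M$ is drawn independently from a fixed law $q$ with $q(w^0)>0$, where $w^0=(0,\dots,0)$. For an action profile $a\in[M]^K$ let $u_k(a,w)=\hat\mu_k(a_k)$ if $k$ is the only player on arm $a_k$ and $w_{a_k}=0$, and $u_k(a,w)=0$ otherwise. **Dynamics with parameter $\varepsilon$.** Player $k$ has a state $(\bar a_k,\bar u_k,S_k)$: baseline action, baseline utility, and mood $S_k\in\{C,D\}$ (content, discontent). In one step, with all random choices independent given the current joint state: 1. A content player plays $\bar a_k$ with probability $1-\varepsilon^\kappa$ and each other arm with probability $\varepsilon^\kappa/(M-1)$; a discontent player plays a uniform arm. Let $a$ be the profile played and $w$ the attack vector. 2. A content player with $a_k=\bar a_k$ keeps its state. Every other player moves to $(a_k,u_k(a,w),C)$ with probability $\varepsilon^{1-u_k(a,w)}$ and to $(a_k,u_k(a,w),D)$ otherwise. 3. If after stage 2 all players are content, nothing changes. Otherwise each player that is then content stays content with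 probability $\varepsilon^\beta$ and becomes discontent otherwise, while discontent players remain so. Initially all players are discontent with baseline utility $0$ and arbitrary baseline actions. Let $\mathcal Z$ be the set of joint states that are reached with positive probability, for some $\varepsilon\in(0,1)$, in one or more steps from an initial state. It is finite. Let $P^\varepsilon$ be the transition matrix on $\mathcal Z$, and $P^0$ the matrix given by the same formulas at $\varepsilon=0$ (with $0^0=1$). Let $\mathcal Z_{C,1}$ be the set of joint states in which all players are content and, for some single attack vector $w$, $\bar u_k=u_k(\bar a,w)$ for all $k$, where $\bar a$ is the baseline action profile. **Theorem.** (i) $(P^\varepsilon)_{0<\varepsilon<1}$ is a regular perturbation of $P^0$: each $P^\varepsilon$ is a stochastic, irreducible and aperiodic matrix; $P^\varepsilon_{zz'}\to P^0_{zz'}$ as $\varepsilon\to0^+$; and whenever $P^\varepsilon_{zz'}>0$ for some $\varepsilon\in(0,1)$ there is $r\ge0$ with $0<\lim_{\varepsilon\to0^+}\varepsilon^{-r}P^\varepsilon_{zz'}<\infty$. (ii) For $0<\varepsilon<1$ the matrix $P^\varepsilon$ has a unique stationary distribution $\mu^\varepsilon$; the limit $\mu^0=\lim_{\varepsilon\to0^+}\mu^\varepsilon$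 exists and is a stationary distribution of $P^0$. A joint state $z$ is called stochastically stable if $z\in\mathcal Z$ and $\mu^0(z)>0$. (iii) A state $z\in\mathcal Z_{C,1}$ is stochastically stable if and only if all players are content, $\bar u_k=u_k(\bar a,w^0)$ for all $k$, and $$\sum_{k=1}^K u_k(\bar a,w^0)=\max_{a\in[M]^K,\;w\in\{0,1\}^M}\ \sum_{k=1}^K u_k(a,w).$$ -/

import Mathlib

open Filter Topology Set

/-! ## Finite Markov chains, regular perturbations, stochastic stability -/

namespace PerturbedChain

variable {S : Type*} [Fintype S]

/-- Row-stochastic matrices. -/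
def IsStochastic (P : Matrix S S ℝ) : Prop :=
  (∀ x y, 0 ≤ P x y) ∧ ∀ x, ∑ y, P x y = 1

open Classical in
/-- Every state leads to every state with positive probability in some number of steps. -/
def IsIrreducible (P : Matrix S S ℝ) : Prop :=
  ∀ x y, ∃ n : ℕ, 0 < (P ^ n) x y

open Classical in
/-- The return times to each state have no common divisor other than `1`. -/
def IsAperiodic (P : Matrix S S ℝ) : Prop :=
  ∀ x, ∀ d : ℕ, (∀ n : ℕ, 0 < n → 0 < (P ^ n) x x → d ∣ n) → d = 1

/-- Ergodic transition matrix: stochastic, irreducible and aperiodic. -/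
def IsErgodic (P : Matrix S S ℝ) : Prop :=
  IsStochastic P ∧ IsIrreducible P ∧ IsAperiodic P

/-- The family `P ε`, `0 < ε < 1`, is a regular perturbation of `P0`. -/
structure IsRegularPerturbation (P0 : Matrix S S ℝ) (P : ℝ → Matrix S S ℝ) : Prop where
  ergodic : ∀ ε ∈ Ioo (0 : ℝ) 1, IsErgodic (P ε)
  tendsto : ∀ x y, Tendsto (fun ε => P ε x y) (𝓝[>] 0) (𝓝 (P0 x y))
  resistance : ∀ x y, (∃ ε ∈ Ioo (0 : ℝ) 1, 0 < P ε x y) →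
    ∃ r : ℝ, 0 ≤ r ∧ ∃ c : ℝ, 0 < c ∧
      Tendsto (fun ε : ℝ => ε ^ (-r) * P ε x y) (𝓝[>] 0) (𝓝 c)

/-- `μ` is a stationary probability distribution of `P`. -/
def IsStationary (P : Matrix S S ℝ) (μ : S → ℝ) : Prop :=
  (∀ x, 0 ≤ μ x) ∧ ∑ x, μ x = 1 ∧ ∀ y, ∑ x, μ x * P x y = μ y

/-- `μ0` is the limit, as `ε → 0⁺`, of the unique stationary distributions of the `P ε`. -/
def IsLimitDistribution (P : ℝ → Matrix S S ℝ) (μ0 : S → ℝ) : Prop :=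
  ∃ μ : ℝ → S → ℝ, (∀ ε ∈ Ioo (0 : ℝ) 1, ∀ ν, IsStationary (P ε) ν ↔ ν = μ ε) ∧
    Tendsto μ (𝓝[>] 0) (𝓝 μ0)

/-- A state is stochastically stable if it lies in the support of the limit distribution. -/
def IsStochasticallyStable (P : ℝ → Matrix S S ℝ) (x : S) : Prop :=
  ∃ μ0, IsLimitDistribution P μ0 ∧ 0 < μ0 x

end PerturbedChain

/-! ## The matching-phase dynamics -/

namespace MatchingPhase

/-- Content or discontent. -/
inductive Mood
  | content
  | discontent
  deriving DecidableEq

instance : Fintype Mood := ⟨{Mood.content, Mood.discontent}, fun m => by cases m <;> simp⟩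

/-- State of one player: baseline action, baseline utility, mood. -/
@[ext]
structure PlayerState (M : ℕ) where
  act : Fin M
  util : ℝ
  mood : Mood

/-- Joint state of the `K` players. -/
abbrev State (K M : ℕ) := Fin K → PlayerState M

/-- Attack vectors: `w m = true` means that arm `m` is attacked. -/
abbrev Attack (M : ℕ) := Fin M → Bool

/-- The vector without any attack. -/
def noAttack (M : ℕ) : Attack M := fun _ => false

/-- Data of the matching phase: the exponents `κ`, `β`, the estimated mean reward `est k m` of
arm `m` for player `k` when alone on it, and the law `q` of the attack vector of a time step
(the attack vectors of distinct time steps are independent). -/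
structure Game (K M : ℕ) where
  κ : ℝ
  β : ℝ
  est : Fin K → Fin M → ℝ
  q : Attack M → ℝ

variable {K M : ℕ}

/-- Number of players that play arm `m`. -/
def load (a : Fin K → Fin M) (m : Fin M) : ℕ := (Finset.univ.filter fun j => a j = m).card

namespace Game

variable (G : Game K M)

/-- Utility of player `k` under the action profile `a` and the attack `w`. -/
noncomputable def utility (k : Fin K) (a : Fin K → Fin M) (w : Attack M) : ℝ :=
  if load a (a k) = 1 ∧ w (a k) = false then G.est k (a k) else 0

/-- Action dynamics: probability that a player in state `s` plays `a`. -/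
noncomputable def actionProb (ε : ℝ) (s : PlayerState M) (a : Fin M) : ℝ :=
  match s.mood with
  | .content => if a = s.act then 1 - ε ^ G.κ else ε ^ G.κ / ((M : ℝ) - 1)
  | .discontent => 1 / (M : ℝ)

/-- State dynamics: probability that a player in state `s` who plays `a` and gets utility `u`
has mood `m` before the moods are synchronized. -/
noncomputable def moodProb (ε : ℝ) (s : PlayerState M) (a : Fin M) (u : ℝ) (m : Mood) : ℝ :=
  if s.mood = .content ∧ a = s.act then (if m = .content then 1 else 0)
  else match m with
    | .content => ε ^ (1 - u)
    | .discontent => 1 - ε ^ (1 - u)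

/-- State dynamics: the state of a player before the moods are synchronized, when this player
was in state `s`, played `a`, got utility `u` and drew the mood `m`. -/
noncomputable def updated (s : PlayerState M) (a : Fin M) (u : ℝ) (m : Mood) : PlayerState M :=
  if s.mood = .content ∧ a = s.act then ⟨s.act, s.util, m⟩ else ⟨a, u, m⟩

/-- Synchronization of moods: probability that a player has mood `m'`, when the updated moods of
all players are `m` and that of this player is `m k`. -/
noncomputable def syncProb (ε : ℝ) (m : Fin K → Mood) (k : Fin K) (m' : Mood) : ℝ :=
  if m k = .discontent ∨ ∀ j, m j = .content then (if m' = m k then 1 else 0)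
  else match m' with
    | .content => ε ^ G.β
    | .discontent => 1 - ε ^ G.β

open Classical in
/-- One-step transition probability `z → z'` of the joint state. -/
noncomputable def transition (ε : ℝ) (z z' : State K M) : ℝ :=
  ∑ w : Attack M, G.q w * ∑ a : Fin K → Fin M, (∏ k, G.actionProb ε (z k) (a k)) *
    ∑ m : Fin K → Mood, (∏ k, moodProb ε (z k) (a k) (G.utility k a w) (m k)) *
      ∏ k, if (z' k).act = (updated (z k) (a k) (G.utility k a w) (m k)).act ∧
              (z' k).util = (updated (z k) (a k) (G.utility k a w) (m k)).util
            then G.syncProb ε m k (z' k).mood else 0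

/-- Initial states: baseline utilities `0`, everybody discontent, arbitrary baseline actions. -/
def IsInitial (z : State K M) : Prop := ∀ k, (z k).util = 0 ∧ (z k).mood = .discontent

/-- States that the dynamics can enter: those reachable from an initial state in one or more
steps. -/
def Enterable (z : State K M) : Prop :=
  ∃ z₀ : State K M, IsInitial z₀ ∧
    Relation.TransGen (fun x y => ∃ ε ∈ Ioo (0 : ℝ) 1, 0 < G.transition ε x y) z₀ z

/-- State space of the Markov chain. -/
abbrev Reach := {z : State K M // G.Enterable z}

theorem util_of_transition {ε : ℝ} {z z' : State K M} (h : 0 < G.transition ε z z') (k : Fin K) :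
    (z' k).util = (z k).util ∨ (z' k).util = 0 ∨ ∃ m, (z' k).util = G.est k m := by
  classical
  unfold transition at h
  obtain ⟨w, -, hw⟩ := Finset.exists_ne_zero_of_sum_ne_zero h.ne'
  obtain ⟨a, -, ha⟩ := Finset.exists_ne_zero_of_sum_ne_zero (right_ne_zero_of_mul hw)
  obtain ⟨m, -, hm⟩ := Finset.exists_ne_zero_of_sum_ne_zero (right_ne_zero_of_mul ha)
  have hk := Finset.prod_ne_zero_iff.mp (right_ne_zero_of_mul hm) k (Finset.mem_univ k)
  have hu := (ite_ne_right_iff.mp hk).1.2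
  unfold updated at hu
  split_ifs at hu with h1
  · exact Or.inl hu
  · simp only [utility] at hu
    split_ifs at hu with h2
    · exact Or.inr (Or.inr ⟨_, hu⟩)
    · exact Or.inr (Or.inl hu)

theorem util_of_enterable {z : State K M} (h : G.Enterable z) (k : Fin K) :
    (z k).util ∈ insert 0 (Set.range (G.est k)) := by
  obtain ⟨z₀, h0, h⟩ := h
  induction h with
  | single h =>
    obtain ⟨ε, -, h⟩ := h
    rcases G.util_of_transition h k with h | h | ⟨m, h⟩
    · exact Or.inl (h.trans (h0 k).1)
    · exact Or.inl h
    · exact Or.inr ⟨m, h.symm⟩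
  | tail _ h ih =>
    obtain ⟨ε, -, h⟩ := h
    rcases G.util_of_transition h k with h | h | ⟨m, h⟩
    · rw [h]; exact ih
    · exact Or.inl h
    · exact Or.inr ⟨m, h.symm⟩

instance : Finite G.Reach := by
  let V (k : Fin K) : Set ℝ := insert 0 (Set.range (G.est k))
  have hV (k : Fin K) : Finite (V k) := ((Set.finite_range (G.est k)).insert 0).to_subtype
  let f : G.Reach → ((k : Fin K) → Fin M × V k × Mood) := fun z k =>
    ((z.1 k).act, ⟨(z.1 k).util, G.util_of_enterable z.2 k⟩, (z.1 k).mood)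
  refine Finite.of_injective f fun x y h => Subtype.ext (funext fun k => ?_)
  have hk := congrFun h k
  simp only [f, Prod.mk.injEq, Subtype.mk.injEq] at hk
  exact PlayerState.ext hk.1 hk.2.1 hk.2.2

noncomputable instance : Fintype G.Reach := Fintype.ofFinite _

/-- The transition matrix `P ε`; `P 0` is the unperturbed process. -/
noncomputable def chain (ε : ℝ) : Matrix G.Reach G.Reach ℝ := fun x y => G.transition ε x.1 y.1

/-- A joint state is stochastically stable if it is a state of the chain and lies in the support
of the limit distribution (states that the chain never enters are not stable). -/
def Stable (z : State K M) : Prop :=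
  ∃ h : G.Enterable z, PerturbedChain.IsStochasticallyStable G.chain ⟨z, h⟩

/-- The baseline action profile of a joint state. -/
def profile (z : State K M) : Fin K → Fin M := fun k => (z k).act

/-- The class of joint states in which all players are content and the baseline utilities are the
utilities of the baseline action profile under one common attack vector. -/
def ContentAligned : Set (State K M) :=
  {z | ∃ w : Attack M, ∀ k, (z k).mood = .content ∧ (z k).util = G.utility k (profile z) w}

end Game

end MatchingPhase

/-! By the Markov chain tree theorem (`sum_treeWeight_mul_eq`), the stationary probability of z is
proportional to the sum, over spanning trees directed towards z, of the products of transition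
probabilities along the tree. Transition probabilities are built by finite sums and products from
constants, ε^r and 1 - ε^r with r ≥ 0, so they and the tree weights are `IsPowerLike`. Hence the
normalized tree weights converge, and a state is stable exactly when its tree weight has the
smallest exponent.

Exponents are bounded below by a potential. A step leaving x has resistance at least `exitCost x` (κ
if everybody is content, else 0) plus the increase of `shortfall`, the sum of 1 - ū_k over the
content players (`transition_le`). Along the tree path from a state of shortfall 0 to the root these
increases telescope. A tree rooted at an all-content z therefore costs at least the sum of
`exitCost` over the other states plus K - ∑ ū_k (`treeWeight_chain_le`).

The bound is attained if the utilities of z are those of its profile without attack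
(`exists_resistance`): every state other than z can be left at its exit cost alone, except that one
all-discontent state pays K - ∑ ū_k to jump to z. A root that is not all-content does not save the κ
that an all-content root saves, and κ > M > K ≥ K - ∑ ū_k. All-content roots are ranked by ∑ ū_k,
which never exceeds the maximal welfare, even for outdated baselines (`sum_util_le`).
`stable_of_maximal` combines these comparisons. -/

namespace PerturbedChain

variable {S : Type*} [Fintype S]

/-! ### Powers of nonnegative matrices, aperiodicity, uniqueness of stationary distributions -/

section Powers

variable [DecidableEq S] {P : Matrix S S ℝ}

theorem pow_apply_nonneg (hP : ∀ x y, 0 ≤ P x y) (n : ℕ) (x y : S) : 0 ≤ (P ^ n) x y := by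
  induction n generalizing y with
  | zero => rw [pow_zero, Matrix.one_apply]; split_ifs <;> norm_num
  | succ n ih =>
    rw [pow_succ, Matrix.mul_apply]
    exact Finset.sum_nonneg fun z _ => mul_nonneg (ih z) (hP z y)

theorem pow_add_apply_pos (hP : ∀ x y, 0 ≤ P x y) {m n : ℕ} {x y z : S}
    (h₁ : 0 < (P ^ m) x y) (h₂ : 0 < (P ^ n) y z) : 0 < (P ^ (m + n)) x z := by
  rw [pow_add, Matrix.mul_apply]
  exact Finset.sum_pos' (fun w _ => mul_nonneg (pow_apply_nonneg hP _ _ _)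
    (pow_apply_nonneg hP _ _ _)) ⟨y, Finset.mem_univ _, mul_pos h₁ h₂⟩

theorem exists_pow_apply_pos_of_reflTransGen (hP : ∀ x y, 0 ≤ P x y) {x y : S}
    (h : Relation.ReflTransGen (fun x y => 0 < P x y) x y) : ∃ n : ℕ, 0 < (P ^ n) x y := by
  induction h with
  | refl => exact ⟨0, by simp⟩
  | tail _ h ih =>
    obtain ⟨n, hn⟩ := ih
    exact ⟨n + 1, pow_add_apply_pos hP hn (by simpa using h)⟩

theorem reflTransGen_of_pow_apply_pos (hP : ∀ x y, 0 ≤ P x y) {n : ℕ} {x y : S}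
    (h : 0 < (P ^ n) x y) : Relation.ReflTransGen (fun x y => 0 < P x y) x y := by
  induction n generalizing y with
  | zero =>
    rw [pow_zero, Matrix.one_apply] at h
    split_ifs at h with hxy
    · rw [hxy]
    · exact absurd h (lt_irrefl _)
  | succ n ih =>
    rw [pow_succ, Matrix.mul_apply] at h
    obtain ⟨z, -, hz⟩ := Finset.exists_ne_zero_of_sum_ne_zero h.ne'
    have h₁ := (pow_apply_nonneg hP n x z).lt_of_ne' (left_ne_zero_of_mul hz)
    have h₂ := (hP z y).lt_of_ne' (right_ne_zero_of_mul hz)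
    exact (ih h₁).tail h₂

end Powers

variable {P : Matrix S S ℝ}

theorem isIrreducible_iff_reflTransGen (hP : ∀ x y, 0 ≤ P x y) :
    IsIrreducible P ↔ ∀ x y, Relation.ReflTransGen (fun x y => 0 < P x y) x y :=
  ⟨fun h x y => (h x y).elim fun _ hn => by
    classical exact reflTransGen_of_pow_apply_pos hP hn, fun h x y => by
    classical exact exists_pow_apply_pos_of_reflTransGen hP (h x y)⟩

/-- A loop from x through s may use the self-loop at s once or twice, which gives two consecutive
return times. -/
theorem IsIrreducible.isAperiodic (hP : ∀ x y, 0 ≤ P x y) (h : IsIrreducible P) {s : S}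
    (hs : 0 < P s s) : IsAperiodic P := by
  classical
  intro x d hd
  obtain ⟨m, hm⟩ := h x s
  obtain ⟨n, hn⟩ := h s x
  have hs' : 0 < (P ^ 1) s s := by simpa using hs
  have h₁ := pow_add_apply_pos hP hm hs'
  have h₂ := hd (m + 1 + n) (by omega) (by convert pow_add_apply_pos hP h₁ hn)
  have h₃ := hd (m + 1 + 1 + n) (by omega)
    (by convert pow_add_apply_pos hP (pow_add_apply_pos hP h₁ hs') hn)
  have h₄ := Nat.dvd_sub h₃ h₂
  rw [show m + 1 + 1 + n - (m + 1 + n) = 1 by omega] at h₄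
  exact Nat.dvd_one.mp h₄

/-- A nonnegative invariant vector of an irreducible chain that vanishes somewhere is zero. -/
theorem IsIrreducible.eq_zero_of_invariant (hP : ∀ x y, 0 ≤ P x y) (h : IsIrreducible P)
    {δ : S → ℝ} (hδ : ∀ x, 0 ≤ δ x) (hinv : ∀ y, ∑ x, δ x * P x y = δ y) {y : S} (hy : δ y = 0)
    (x : S) : δ x = 0 := by
  have key := (isIrreducible_iff_reflTransGen hP).mp h x y
  induction key using Relation.ReflTransGen.head_induction_on with
  | refl => exact hy
  | @head a c hxz _ ih =>
    -- Zeros spread backwards: no mass at c forces no mass at any state that can step to c.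
    have h₀ := hinv c
    rw [ih, Finset.sum_eq_zero_iff_of_nonneg fun x _ => mul_nonneg (hδ x) (hP x c)] at h₀
    exact (mul_eq_zero.mp (h₀ a (Finset.mem_univ _))).resolve_right hxz.ne'

theorem IsStationary.pos (hP : ∀ x y, 0 ≤ P x y) (h : IsIrreducible P) {μ : S → ℝ}
    (hμ : IsStationary P μ) (x : S) : 0 < μ x := by
  refine (hμ.1 x).lt_of_ne fun hx => ?_
  have h₀ := h.eq_zero_of_invariant hP hμ.1 hμ.2.2 hx.symm
  have h₁ := hμ.2.1
  simp [h₀] at h₁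

/-- With c the minimal ratio ν/μ, the vector ν - cμ is nonnegative, invariant and zero somewhere,
hence zero; comparing total masses gives c = 1. -/
theorem IsStationary.eq (hP : ∀ x y, 0 ≤ P x y) (h : IsIrreducible P) {μ ν : S → ℝ}
    (hμ : IsStationary P μ) (hν : IsStationary P ν) : ν = μ := by
  have hne : Nonempty S := by
    by_contra hS
    rw [not_nonempty_iff] at hS
    simpa using hμ.2.1
  obtain ⟨s, hs⟩ := Finite.exists_min fun x => ν x / μ x
  set c := ν s / μ s
  have hpos := hμ.pos hP h
  have h₀ := h.eq_zero_of_invariant hP (δ := fun x => ν x - c * μ x) (y := s)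
    (fun x => sub_nonneg.mpr ((le_div_iff₀ (hpos x)).mp (hs x)))
    (fun y => by
      simp only [sub_mul, Finset.sum_sub_distrib, mul_assoc, ← Finset.mul_sum, hμ.2.2, hν.2.2])
    (by simp [c, div_mul_cancel₀ _ (hpos s).ne'])
  have hc : c = 1 := by
    have h₁ := Finset.sum_eq_zero fun x (_ : x ∈ Finset.univ) => h₀ x
    rw [Finset.sum_sub_distrib, ← Finset.mul_sum, hμ.2.1, hν.2.1] at h₁
    linarith
  funext x
  have h₁ := h₀ x
  simp only [hc, one_mul] at h₁
  linarith

/-! ### Spanning in-trees and the Markov chain tree theorem -/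

/-- Every state reaches `y` by iterating `f`. -/
def LeadsTo (f : S → S) (y : S) : Prop := ∀ x, ∃ n : ℕ, f^[n] x = y

section Trees

variable [DecidableEq S]

-- The orbit up to its first visit to y does not use the value of f at y.
omit [Fintype S] in
theorem exists_iterate_update {f : S → S} {x y : S} (z : S) (h : ∃ n : ℕ, f^[n] x = y) :
    ∃ n : ℕ, (Function.update f y z)^[n] x = y := by
  obtain ⟨n, hn⟩ := h
  induction n generalizing x with
  | zero => exact ⟨0, hn⟩
  | succ n ih =>
    by_cases hx : x = y
    · exact ⟨0, hx⟩
    · obtain ⟨k, hk⟩ := ih hn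
      exact ⟨k + 1, by rwa [Function.iterate_succ_apply, Function.update_of_ne hx]⟩

omit [Fintype S] in
theorem LeadsTo.update {f : S → S} {y : S} (h : LeadsTo f y) (z : S) :
    LeadsTo (Function.update f y z) y := fun x => exists_iterate_update z (h x)

omit [Fintype S] [DecidableEq S] in
theorem LeadsTo.of_apply {f : S → S} {x y : S} (h : LeadsTo f x) {n : ℕ} (hxy : f^[n] x = y) :
    LeadsTo f y := fun s => by
  obtain ⟨m, hm⟩ := h s
  exact ⟨n + m, by rw [Function.iterate_add_apply, hm, hxy]⟩

open Classical in
/-- The spanning trees directed towards the root `z`, as successor functions that fix `z`. -/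
noncomputable def inTrees (z : S) : Finset (S → S) := {f | f z = z ∧ LeadsTo f z}

theorem mem_inTrees {z : S} {f : S → S} : f ∈ inTrees z ↔ f z = z ∧ LeadsTo f z := by
  simp [inTrees]

/-- The total weight of the spanning trees directed towards `z`. -/
noncomputable def treeWeight (P : Matrix S S ℝ) (z : S) : ℝ :=
  ∑ f ∈ inTrees z, ∏ x ∈ Finset.univ.erase z, P x (f x)

theorem prod_update (P : Matrix S S ℝ) (f : S → S) (x y : S) :
    ∏ s, P s (Function.update f x y s) = P x y * ∏ s ∈ Finset.univ.erase x, P s (f s) := by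
  rw [← Finset.mul_prod_erase _ _ (Finset.mem_univ x), Function.update_self]
  congr 1
  exact Finset.prod_congr rfl fun s hs => by
    rw [Function.update_of_ne (Finset.ne_of_mem_erase hs)]

-- If everything leads to y, the value g y is unconstrained: cutting it leaves a tree rooted at y,
-- and summing over it gives the row sum 1.
open Classical in
theorem sum_leadsTo_prod (hP : IsStochastic P) (y : S) :
    ∑ g : S → S with LeadsTo g y, ∏ x, P x (g x) = treeWeight P y := by
  have : treeWeight P y = ∑ p ∈ inTrees y ×ˢ (Finset.univ : Finset S),
      ∏ x, P x (Function.update p.1 y p.2 x) := by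
    rw [Finset.sum_product, treeWeight]
    refine Finset.sum_congr rfl fun f _ => ?_
    simp only [prod_update]
    rw [← Finset.sum_mul, hP.2, one_mul]
  rw [this]
  refine Finset.sum_nbij' (fun g => (Function.update g y y, g y))
    (fun p => Function.update p.1 y p.2) ?_ ?_ ?_ ?_ ?_
  · intro g hg
    simp only [Finset.mem_filter, Finset.mem_univ, true_and] at hg
    simp only [Finset.mem_product, mem_inTrees, Function.update_self, Finset.mem_univ, and_true,
      true_and]
    exact hg.update y
  · rintro ⟨f, z⟩ hf
    simp only [Finset.mem_product, mem_inTrees, Finset.mem_univ, and_true] at hf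
    simpa using hf.2.update z
  · intro g _
    simp
  · rintro ⟨f, z⟩ hf
    simp only [Finset.mem_product, mem_inTrees, Finset.mem_univ, and_true] at hf
    have : Function.update f y y = f := by
      conv_lhs => rw [← Function.update_eq_self y f]
      rw [hf.1]; simp [hf.1]
    simp [this]
  · intro g _
    simp

omit [Fintype S] [DecidableEq S] in
/-- The predecessor of a periodic point on its cycle is unique. -/
theorem iterate_eq_of_iterate_succ {g : S → S} {y : S} {m n : ℕ} (hm : g^[m + 1] y = y)
    (hn : g^[n + 1] y = y) : g^[m] y = g^[n] y := by
  have h₁ (k : ℕ) : g^[(m + 1) * k] y = y := by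
    rw [Function.iterate_mul]; exact Function.iterate_fixed hm k
  have h₂ (k : ℕ) : g^[(n + 1) * k] y = y := by
    rw [Function.iterate_mul]; exact Function.iterate_fixed hn k
  -- Both exponents equal (m + 1)(n + 1) - 1.
  calc g^[m] y = g^[m + (m + 1) * n] y := by rw [Function.iterate_add_apply, h₁]
    _ = g^[n + (n + 1) * m] y := by
        rw [show m + (m + 1) * n = n + (n + 1) * m by ring]
    _ = g^[n] y := by rw [Function.iterate_add_apply, h₂]

-- Adding the edge x → y to a tree rooted at x gives a map under which everything leads to y. The
-- root x is recovered as the predecessor of y on the cycle through y, so the correspondence is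
-- bijective.
open Classical in
theorem sum_treeWeight_mul (P : Matrix S S ℝ) (y : S) :
    ∑ x, treeWeight P x * P x y = ∑ g : S → S with LeadsTo g y, ∏ x, P x (g x) := by
  have : ∑ x, treeWeight P x * P x y = ∑ p ∈ Finset.univ.sigma fun x : S => inTrees x,
      ∏ s, P s (Function.update p.2 p.1 y s) := by
    rw [Finset.sum_sigma]
    refine Finset.sum_congr rfl fun x _ => ?_
    rw [treeWeight, Finset.sum_mul]
    exact Finset.sum_congr rfl fun f _ => by rw [prod_update, mul_comm]
  rw [this]
  refine Finset.sum_bij (fun p _ => Function.update p.2 p.1 y) ?_ ?_ ?_ fun _ _ => rfl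
  · rintro ⟨x, f⟩ hf
    simp only [Finset.mem_sigma, mem_inTrees, Finset.mem_univ, true_and] at hf
    simp only [Finset.mem_filter, Finset.mem_univ, true_and]
    exact (hf.2.update y).of_apply (n := 1) (by simp)
  · rintro ⟨x, f⟩ hf ⟨x', f'⟩ hf' h
    simp only [Finset.mem_sigma, mem_inTrees, Finset.mem_univ, true_and] at hf hf'
    dsimp only at h
    have hx : x = x' := by
      obtain ⟨m, hm⟩ := hf.2.update y y
      obtain ⟨n, hn⟩ := hf'.2.update y y
      rw [← hm, ← hn, h]
      refine iterate_eq_of_iterate_succ ?_ ?_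
      · rw [Function.iterate_succ_apply', ← h, hm, Function.update_self]
      · rw [Function.iterate_succ_apply', hn, Function.update_self]
    subst hx
    refine Sigma.ext rfl (heq_of_eq (funext fun s => ?_))
    by_cases hs : s = x
    · rw [hs]; exact hf.1.trans hf'.1.symm
    · simpa [hs] using congrFun h s
  · intro g hg
    simp only [Finset.mem_filter, Finset.mem_univ, true_and] at hg
    -- The orbit of y returns to y; the state just before the return is the root of the tree sought.
    obtain ⟨n, hn⟩ := hg (g y)
    have hgx : g (g^[n] y) = y := by
      rw [← Function.iterate_succ_apply' g n y, Function.iterate_succ_apply, hn]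
    refine ⟨⟨g^[n] y, Function.update g (g^[n] y) (g^[n] y)⟩, ?_, ?_⟩
    · simp only [Finset.mem_sigma, mem_inTrees, Finset.mem_univ, true_and, Function.update_self]
      exact (hg.of_apply rfl).update _
    · simp [hgx]

/-- The Markov chain tree theorem. -/
theorem sum_treeWeight_mul_eq (hP : IsStochastic P) (y : S) :
    ∑ x, treeWeight P x * P x y = treeWeight P y := by
  classical rw [sum_treeWeight_mul, sum_leadsTo_prod hP]

omit [Fintype S] [DecidableEq S] in
/-- If every state reaches `z` along edges of `E`, some tree directed towards `z` uses only such
edges. -/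
theorem exists_tree_of_reflTransGen {E : S → S → Prop} {z : S}
    (h : ∀ x, Relation.ReflTransGen E x z) :
    ∃ f : S → S, f z = z ∧ LeadsTo f z ∧ ∀ x, x ≠ z → E x (f x) := by
  classical
  -- D n consists of the states with a walk of exactly n edges to z; stepping to a state of smaller
  -- least n gives the tree.
  let D (n : ℕ) : Set S :=
    Nat.rec (motive := fun _ => Set S) {z} (fun _ A => {x | ∃ y ∈ A, E x y}) n
  have hD (x : S) : ∃ n, x ∈ D n := by
    induction h x using Relation.ReflTransGen.head_induction_on with
    | refl => exact ⟨0, rfl⟩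
    | head hE _ ih => exact ih.elim fun n hn => ⟨n + 1, _, hn, hE⟩
  have hstep (x : S) (hx : x ≠ z) : ∃ y : S, E x y ∧ Nat.find (hD y) < Nat.find (hD x) := by
    have h₁ := Nat.find_spec (hD x)
    obtain ⟨n, hn⟩ : ∃ n, Nat.find (hD x) = n + 1 := by
      refine Nat.exists_eq_succ_of_ne_zero fun h₀ => hx ?_
      rw [h₀] at h₁; exact h₁
    rw [hn] at h₁ ⊢
    obtain ⟨y, hy, hE⟩ := h₁
    exact ⟨y, hE, Nat.lt_succ_of_le (Nat.find_min' _ hy)⟩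
  choose! g hg using hstep
  let f := fun x => if x = z then z else g x
  have hf (x : S) (hx : x ≠ z) : f x = g x := if_neg hx
  refine ⟨f, if_pos rfl, fun x => ?_, fun x hx => by rw [hf x hx]; exact (hg x hx).1⟩
  induction hn : Nat.find (hD x) using Nat.strong_induction_on generalizing x with
  | _ n ih =>
    by_cases hx : x = z
    · exact ⟨0, hx⟩
    · obtain ⟨k, hk⟩ := ih _ (hn ▸ (hg x hx).2) (g x) rfl
      exact ⟨k + 1, by rw [Function.iterate_succ_apply, hf x hx, hk]⟩

theorem treeWeight_nonneg (hP : ∀ x y, 0 ≤ P x y) (z : S) : 0 ≤ treeWeight P z :=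
  Finset.sum_nonneg fun _ _ => Finset.prod_nonneg fun _ _ => hP _ _

theorem prod_le_treeWeight (hP : ∀ x y, 0 ≤ P x y) {z : S} {f : S → S} (hf : f ∈ inTrees z) :
    ∏ x ∈ Finset.univ.erase z, P x (f x) ≤ treeWeight P z :=
  Finset.single_le_sum (f := fun f : S → S => ∏ x ∈ Finset.univ.erase z, P x (f x))
    (fun _ _ => Finset.prod_nonneg fun _ _ => hP _ _) hf

theorem IsIrreducible.treeWeight_pos (hP : ∀ x y, 0 ≤ P x y) (h : IsIrreducible P) (z : S) :
    0 < treeWeight P z := by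
  obtain ⟨f, hfz, hf, hE⟩ := exists_tree_of_reflTransGen fun x =>
    (isIrreducible_iff_reflTransGen hP).mp h x z
  exact (Finset.prod_pos fun x hx => hE x (Finset.ne_of_mem_erase hx)).trans_le
    (prod_le_treeWeight hP (mem_inTrees.mpr ⟨hfz, hf⟩))

theorem isStationary_treeWeight [Nonempty S] (hP : IsStochastic P) (h : IsIrreducible P) :
    IsStationary P fun z => treeWeight P z / ∑ x, treeWeight P x := by
  have hpos : 0 < ∑ x, treeWeight P x :=
    Finset.sum_pos (fun x _ => h.treeWeight_pos hP.1 x) Finset.univ_nonempty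
  refine ⟨fun x => div_nonneg (treeWeight_nonneg hP.1 x) hpos.le, ?_, fun y => ?_⟩
  · rw [← Finset.sum_div, div_self hpos.ne']
  · simp only [div_mul_eq_mul_div]
    rw [← Finset.sum_div, sum_treeWeight_mul_eq hP]

/-- Along the tree path from `s` to the root `z` a potential grows by `φ z - φ s`. -/
theorem sub_le_sum_erase {f : S → S} {z : S} (hf : LeadsTo f z) (φ : S → ℝ) (s : S) :
    φ z - φ s ≤ ∑ x ∈ Finset.univ.erase z, max 0 (φ (f x) - φ x) := by
  classical
  have hs := hf s
  set n := Nat.find hs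
  have hn : f^[n] s = z := Nat.find_spec hs
  have hmin (m : ℕ) (hm : m < n) : f^[m] s ≠ z := Nat.find_min hs hm
  -- Before its first visit to z the path repeats no state, since a repetition would give a shortcut
  -- to z. Each increment is thus charged to its own x ≠ z.
  have hinj : Set.InjOn (fun i => f^[i] s) (Finset.range n) := by
    have key (i j : ℕ) (hij : i < j) (hj : j < n) (h : f^[i] s = f^[j] s) : False := by
      refine hmin (n - j + i) (by omega) ?_
      rw [Function.iterate_add_apply, h, ← Function.iterate_add_apply, Nat.sub_add_cancel hj.le,
        hn]
    intro i hi j hj h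
    simp only [Finset.coe_range, Set.mem_Iio] at hi hj
    rcases lt_trichotomy i j with hij | hij | hij
    · exact (key i j hij hj h).elim
    · exact hij
    · exact (key j i hij hi h.symm).elim
  calc φ z - φ s = ∑ i ∈ Finset.range n, (φ (f^[i + 1] s) - φ (f^[i] s)) := by
        rw [Finset.sum_range_sub fun i => φ (f^[i] s), hn]; rfl
    _ ≤ ∑ i ∈ Finset.range n, max 0 (φ (f (f^[i] s)) - φ (f^[i] s)) :=
        Finset.sum_le_sum fun i _ => by
          rw [Function.iterate_succ_apply']; exact le_max_right _ _
    _ = ∑ x ∈ (Finset.range n).image fun i => f^[i] s, max 0 (φ (f x) - φ x) :=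
        (Finset.sum_image (f := fun x => max 0 (φ (f x) - φ x)) hinj).symm
    _ ≤ _ := by
        refine Finset.sum_le_sum_of_subset_of_nonneg (fun x hx => ?_)
          fun _ _ _ => le_max_left _ _
        obtain ⟨i, hi, rfl⟩ := Finset.mem_image.mp hx
        exact Finset.mem_erase.mpr ⟨hmin i (Finset.mem_range.mp hi), Finset.mem_univ _⟩

/-- An upper bound for the tree weights from a bound on the transition probabilities by powers of
`ε` whose exponents dominate `b` plus the increments of a potential `φ`. -/
theorem treeWeight_le {ε C : ℝ} (hε : ε ∈ Ioo (0 : ℝ) 1) (hC : 0 ≤ C) (hP : ∀ x y, 0 ≤ P x y)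
    {b φ : S → ℝ}
    (h : ∀ x y, x ≠ y → P x y ≤ C * ε ^ (b x + max 0 (φ y - φ x))) (s z : S) :
    treeWeight P z ≤ (Fintype.card (S → S) * C ^ (Fintype.card S - 1)) *
      ε ^ (∑ x ∈ Finset.univ.erase z, b x + (φ z - φ s)) := by
  have hcard : ((inTrees z).card : ℝ) ≤ Fintype.card (S → S) := by
    exact_mod_cast Finset.card_le_univ _
  rw [treeWeight, mul_assoc]
  refine le_trans ?_ (mul_le_mul_of_nonneg_right hcard
    (mul_nonneg (pow_nonneg hC _) (Real.rpow_nonneg hε.1.le _)))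
  rw [← nsmul_eq_mul]
  refine Finset.sum_le_card_nsmul _ _ _ fun f hf => ?_
  obtain ⟨hfz, hf⟩ := mem_inTrees.mp hf
  -- A tree has no loops away from its root, so a bound on off-diagonal entries suffices.
  have hne (x : S) (hx : x ≠ z) : x ≠ f x := fun hfx => by
    obtain ⟨n, hn⟩ := hf x
    exact hx (by rw [← hn, Function.iterate_fixed hfx.symm])
  calc ∏ x ∈ Finset.univ.erase z, P x (f x)
      ≤ ∏ x ∈ Finset.univ.erase z, C * ε ^ (b x + max 0 (φ (f x) - φ x)) :=
        Finset.prod_le_prod (fun x _ => hP _ _)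
          fun x hx => h _ _ (hne x (Finset.ne_of_mem_erase hx))
    _ = C ^ (Fintype.card S - 1) *
        ε ^ ∑ x ∈ Finset.univ.erase z, (b x + max 0 (φ (f x) - φ x)) := by
        rw [Finset.prod_mul_distrib, Finset.prod_const, Finset.card_erase_of_mem
          (Finset.mem_univ z), Finset.card_univ, Real.rpow_sum_of_pos hε.1]
    _ ≤ _ := by
        refine mul_le_mul_of_nonneg_left (Real.rpow_le_rpow_of_exponent_ge hε.1 hε.2.le ?_)
          (pow_nonneg hC _)
        rw [Finset.sum_add_distrib]
        exact add_le_add_right (sub_le_sum_erase hf φ s) _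

end Trees

end PerturbedChain

/-! ### Leading orders as ε → 0⁺ -/

namespace PerturbedChain

/-- `f ε` behaves like a positive multiple of `ε ^ r` as `ε → 0⁺`. -/
def HasLeadingOrder (f : ℝ → ℝ) (r : ℝ) : Prop :=
  ∃ c : ℝ, 0 < c ∧ Tendsto (fun ε : ℝ => ε ^ (-r) * f ε) (𝓝[>] 0) (𝓝 c)

theorem eventually_mem_Ioo : ∀ᶠ ε : ℝ in 𝓝[>] 0, ε ∈ Ioo (0 : ℝ) 1 :=
  Ioo_mem_nhdsGT one_pos

theorem tendsto_rpow_zero {r : ℝ} (hr : 0 < r) :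
    Tendsto (fun ε : ℝ => ε ^ r) (𝓝[>] 0) (𝓝 0) := by
  have h := (Real.continuous_rpow_const hr.le).tendsto (0 : ℝ)
  rw [Real.zero_rpow hr.ne'] at h
  exact h.mono_left nhdsWithin_le_nhds

namespace HasLeadingOrder

variable {f g : ℝ → ℝ} {r s : ℝ}

theorem congr (hf : HasLeadingOrder f r) (h : f =ᶠ[𝓝[>] 0] g) : HasLeadingOrder g r := by
  obtain ⟨c, hc, hl⟩ := hf
  refine ⟨c, hc, hl.congr' ?_⟩
  filter_upwards [h] with ε hε
  rw [hε]

theorem mul (hf : HasLeadingOrder f r) (hg : HasLeadingOrder g s) :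
    HasLeadingOrder (fun ε => f ε * g ε) (r + s) := by
  obtain ⟨c, hc, hl⟩ := hf
  obtain ⟨d, hd, hm⟩ := hg
  refine ⟨c * d, mul_pos hc hd, (hl.mul hm).congr' ?_⟩
  filter_upwards [eventually_mem_Ioo] with ε hε
  rw [neg_add, Real.rpow_add hε.1]
  ring

theorem of_tendsto {c : ℝ} (hc : 0 < c) (h : Tendsto f (𝓝[>] 0) (𝓝 c)) : HasLeadingOrder f 0 :=
  ⟨c, hc, by simpa using h⟩

theorem const {c : ℝ} (hc : 0 < c) : HasLeadingOrder (fun _ => c) 0 :=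
  of_tendsto hc tendsto_const_nhds

theorem rpow (r : ℝ) : HasLeadingOrder (fun ε => ε ^ r) r := by
  refine ⟨1, one_pos, tendsto_const_nhds.congr' ?_⟩
  filter_upwards [eventually_mem_Ioo] with ε hε
  rw [← Real.rpow_add hε.1, neg_add_cancel, Real.rpow_zero]

theorem one_sub_rpow (hr : 0 < r) : HasLeadingOrder (fun ε => 1 - ε ^ r) 0 :=
  of_tendsto one_pos (by simpa using (tendsto_rpow_zero hr).const_sub 1)

theorem prod {ι : Type*} {t : Finset ι} {f : ι → ℝ → ℝ} {r : ι → ℝ}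
    (h : ∀ i ∈ t, HasLeadingOrder (f i) (r i)) :
    HasLeadingOrder (fun ε => ∏ i ∈ t, f i ε) (∑ i ∈ t, r i) := by
  classical
  induction t using Finset.induction_on with
  | empty => simpa using const one_pos
  | insert i t hi ih =>
    simp only [Finset.prod_insert hi, Finset.sum_insert hi]
    exact (h i (Finset.mem_insert_self i t)).mul
      (ih fun j hj => h j (Finset.mem_insert_of_mem hj))

theorem add_of_lt (hf : HasLeadingOrder f r) (hg : HasLeadingOrder g s) (hrs : r < s) :
    HasLeadingOrder (fun ε => f ε + g ε) r := by
  obtain ⟨c, hc, hl⟩ := hf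
  obtain ⟨d, hd, hm⟩ := hg
  refine ⟨c, hc, ?_⟩
  have h := hl.add ((tendsto_rpow_zero (sub_pos.mpr hrs)).mul hm)
  rw [zero_mul, add_zero] at h
  refine h.congr' ?_
  filter_upwards [eventually_mem_Ioo] with ε hε
  rw [← mul_assoc, ← Real.rpow_add hε.1, mul_add]
  ring_nf

theorem add (hf : HasLeadingOrder f r) (hg : HasLeadingOrder g s) :
    HasLeadingOrder (fun ε => f ε + g ε) (min r s) := by
  rcases lt_trichotomy r s with h | rfl | h
  · rw [min_eq_left h.le]; exact hf.add_of_lt hg h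
  · obtain ⟨c, hc, hl⟩ := hf
    obtain ⟨d, hd, hm⟩ := hg
    rw [min_self]
    exact ⟨c + d, add_pos hc hd, by simpa only [mul_add] using hl.add hm⟩
  · rw [min_eq_right h.le]; simpa only [add_comm] using hg.add_of_lt hf h

theorem exists_le (hf : HasLeadingOrder f r) :
    ∃ c : ℝ, 0 < c ∧ ∀ᶠ ε in 𝓝[>] 0, c * ε ^ r ≤ f ε := by
  obtain ⟨c, hc, hl⟩ := hf
  refine ⟨c / 2, half_pos hc, ?_⟩
  filter_upwards [hl.eventually_const_le (half_lt_self hc), eventually_mem_Ioo] with ε h hε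
  rwa [Real.rpow_neg hε.1.le, inv_mul_eq_div, le_div_iff₀ (Real.rpow_pos_of_pos hε.1 _)] at h

end HasLeadingOrder

/-- Functions on `(0, 1)` that vanish identically, or are positive and behave like a positive
multiple of a nonnegative power of `ε` at `0`. -/
def IsPowerLike (f : ℝ → ℝ) : Prop :=
  (∀ ε ∈ Ioo (0 : ℝ) 1, f ε = 0) ∨
    (∀ ε ∈ Ioo (0 : ℝ) 1, 0 < f ε) ∧ ∃ r : ℝ, 0 ≤ r ∧ HasLeadingOrder f r

namespace IsPowerLike

variable {f g : ℝ → ℝ}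

theorem nonneg (hf : IsPowerLike f) {ε : ℝ} (hε : ε ∈ Ioo (0 : ℝ) 1) : 0 ≤ f ε := by
  rcases hf with hf | hf
  · exact (hf ε hε).ge
  · exact (hf.1 ε hε).le

theorem pos_of_pos (hf : IsPowerLike f) {ε ε' : ℝ} (hε : ε ∈ Ioo (0 : ℝ) 1) (h : 0 < f ε)
    (hε' : ε' ∈ Ioo (0 : ℝ) 1) : 0 < f ε' := by
  rcases hf with hf | hf
  · exact absurd (hf ε hε) h.ne'
  · exact hf.1 ε' hε'

theorem zero : IsPowerLike fun _ => 0 := Or.inl fun _ _ => rfl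

theorem const {c : ℝ} (hc : 0 ≤ c) : IsPowerLike fun _ => c := by
  rcases hc.eq_or_lt with rfl | hc
  · exact zero
  · exact Or.inr ⟨fun _ _ => hc, 0, le_rfl, .const hc⟩

theorem rpow {r : ℝ} (hr : 0 ≤ r) : IsPowerLike fun ε => ε ^ r :=
  Or.inr ⟨fun _ hε => Real.rpow_pos_of_pos hε.1 _, r, hr, .rpow r⟩

theorem one_sub_rpow {r : ℝ} (hr : 0 ≤ r) : IsPowerLike fun ε => 1 - ε ^ r := by
  rcases hr.eq_or_lt with rfl | hr
  · exact Or.inl fun ε _ => by simp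
  · exact Or.inr ⟨fun ε hε => sub_pos.mpr (Real.rpow_lt_one hε.1.le hε.2 hr), 0, le_rfl,
      .one_sub_rpow hr⟩

theorem mul (hf : IsPowerLike f) (hg : IsPowerLike g) : IsPowerLike fun ε => f ε * g ε := by
  rcases hf with hf | ⟨hf, r, hr, hfr⟩
  · exact Or.inl fun ε hε => by simp [hf ε hε]
  rcases hg with hg | ⟨hg, s, hs, hgs⟩
  · exact Or.inl fun ε hε => by simp [hg ε hε]
  exact Or.inr ⟨fun ε hε => mul_pos (hf ε hε) (hg ε hε), r + s, add_nonneg hr hs, hfr.mul hgs⟩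

theorem congr (hf : IsPowerLike f) (h : ∀ ε ∈ Ioo (0 : ℝ) 1, f ε = g ε) : IsPowerLike g := by
  rcases hf with hf | ⟨hf, r, hr, hfr⟩
  · exact Or.inl fun ε hε => by rw [← h ε hε, hf ε hε]
  · exact Or.inr ⟨fun ε hε => h ε hε ▸ hf ε hε, r, hr, hfr.congr
      (eventually_mem_Ioo.mono fun ε hε => h ε hε)⟩

theorem add (hf : IsPowerLike f) (hg : IsPowerLike g) : IsPowerLike fun ε => f ε + g ε := by
  rcases hf with hf | ⟨hf, r, hr, hfr⟩
  · exact hg.congr fun ε hε => by rw [hf ε hε, zero_add]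
  rcases hg with hg | ⟨hg, s, hs, hgs⟩
  · exact congr (Or.inr ⟨hf, r, hr, hfr⟩) fun ε hε => by rw [hg ε hε, add_zero]
  exact Or.inr ⟨fun ε hε => add_pos (hf ε hε) (hg ε hε), min r s, le_min hr hs, hfr.add hgs⟩

theorem sum {ι : Type*} {t : Finset ι} {f : ι → ℝ → ℝ} (h : ∀ i ∈ t, IsPowerLike (f i)) :
    IsPowerLike fun ε => ∑ i ∈ t, f i ε := by
  classical
  induction t using Finset.induction_on with
  | empty => simpa using zero
  | insert i t hi ih =>
    simp only [Finset.sum_insert hi]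
    exact (h i (Finset.mem_insert_self i t)).add
      (ih fun j hj => h j (Finset.mem_insert_of_mem hj))

theorem prod {ι : Type*} {t : Finset ι} {f : ι → ℝ → ℝ} (h : ∀ i ∈ t, IsPowerLike (f i)) :
    IsPowerLike fun ε => ∏ i ∈ t, f i ε := by
  classical
  induction t using Finset.induction_on with
  | empty => simpa using const zero_le_one
  | insert i t hi ih =>
    simp only [Finset.prod_insert hi]
    exact (h i (Finset.mem_insert_self i t)).mul
      (ih fun j hj => h j (Finset.mem_insert_of_mem hj))

/-- A quotient of comparable power-like functions has a limit. -/
theorem exists_tendsto_div (hf : IsPowerLike f) (hg : IsPowerLike g)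
    (hle : ∀ ε ∈ Ioo (0 : ℝ) 1, f ε ≤ g ε) :
    ∃ l : ℝ, Tendsto (fun ε => f ε / g ε) (𝓝[>] 0) (𝓝 l) := by
  rcases hf with hf | ⟨hf, r, hr, c, hc, hfr⟩
  · exact ⟨0, tendsto_const_nhds.congr' (eventually_mem_Ioo.mono fun ε hε => by simp [hf ε hε])⟩
  rcases hg with hg | ⟨hg, s, hs, d, hd, hgs⟩
  · exact ⟨0, tendsto_const_nhds.congr' (eventually_mem_Ioo.mono fun ε hε => by simp [hg ε hε])⟩
  have hq := hfr.div hgs hd.ne'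
  have heq : ∀ᶠ ε : ℝ in 𝓝[>] 0, ε ^ (-r) * f ε / (ε ^ (-s) * g ε) =
      ε ^ (s - r) * (f ε / g ε) := eventually_mem_Ioo.mono fun ε hε => by
    rw [mul_div_mul_comm, ← Real.rpow_sub hε.1]
    ring_nf
  -- If r < s, then f/g would be unbounded, contradicting f ≤ g.
  rcases lt_or_ge r s with hrs | hrs
  · exfalso
    have h₀ : Tendsto (fun ε => ε ^ (s - r) * (f ε / g ε)) (𝓝[>] 0) (𝓝 0) := by
      refine tendsto_of_tendsto_of_tendsto_of_le_of_le' tendsto_const_nhds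
        (tendsto_rpow_zero (sub_pos.mpr hrs)) ?_ ?_
      · filter_upwards [eventually_mem_Ioo] with ε hε
        exact mul_nonneg (Real.rpow_nonneg hε.1.le _) (div_nonneg (hf ε hε).le (hg ε hε).le)
      · filter_upwards [eventually_mem_Ioo] with ε hε
        exact mul_le_of_le_one_right (Real.rpow_nonneg hε.1.le _)
          ((div_le_one (hg ε hε)).mpr (hle ε hε))
    exact (div_pos hc hd).ne' (tendsto_nhds_unique (hq.congr' heq) h₀)
  -- The limit `0 ^ (r - s)` is 1 when r = s and 0 otherwise, so both cases are covered.
  · have hp := ((Real.continuous_rpow_const (sub_nonneg.mpr hrs)).tendsto (0 : ℝ)).mono_left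
      (nhdsWithin_le_nhds (s := Ioi 0))
    refine ⟨_, (hp.mul hq).congr' ?_⟩
    filter_upwards [eventually_mem_Ioo, heq] with ε hε h
    rw [Pi.div_apply, h, ← mul_assoc, ← Real.rpow_add hε.1, sub_add_sub_cancel, sub_self,
      Real.rpow_zero,
      one_mul]

end IsPowerLike

/-! ### Limits of normalized tree weights -/

section Limit

variable {S : Type*} [Fintype S] [DecidableEq S] [Nonempty S] {P0 : Matrix S S ℝ}
  {P : ℝ → Matrix S S ℝ}

omit [Nonempty S] in
theorem isPowerLike_treeWeight (h : ∀ x y, IsPowerLike fun ε => P ε x y) (z : S) :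
    IsPowerLike fun ε => treeWeight (P ε) z :=
  .sum fun _ _ => .prod fun _ _ => h _ _

/-- The limit distribution of a regular perturbation is the limit of the normalized tree
weights. -/
theorem exists_tendsto_treeWeight (hP : IsRegularPerturbation P0 P)
    (h : ∀ x y, IsPowerLike fun ε => P ε x y) :
    ∃ μ0, IsLimitDistribution P μ0 ∧ IsStationary P0 μ0 ∧
      ∀ z, Tendsto (fun ε => treeWeight (P ε) z / ∑ x, treeWeight (P ε) x) (𝓝[>] 0)
        (𝓝 (μ0 z)) := by
  have hT := isPowerLike_treeWeight h
  have hlim (z : S) := (hT z).exists_tendsto_div (IsPowerLike.sum fun x _ => hT x)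
    fun ε hε => Finset.single_le_sum (fun x _ => (hT x).nonneg hε) (Finset.mem_univ z)
  choose μ0 hμ0 using hlim
  have hstat (ε : ℝ) (hε : ε ∈ Ioo (0 : ℝ) 1) :=
    isStationary_treeWeight (hP.ergodic ε hε).1 (hP.ergodic ε hε).2.1
  refine ⟨μ0, ⟨fun ε z => treeWeight (P ε) z / ∑ x, treeWeight (P ε) x, fun ε hε ν => ?_,
    tendsto_pi_nhds.mpr hμ0⟩, ⟨fun z => ?_, ?_, fun y => ?_⟩, hμ0⟩
  · refine ⟨fun hν => ?_, fun hν => hν ▸ hstat ε hε⟩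
    exact (hstat ε hε).eq (hP.ergodic ε hε).1.1 (hP.ergodic ε hε).2.1 hν
  · exact ge_of_tendsto (hμ0 z) (eventually_mem_Ioo.mono fun ε hε => (hstat ε hε).1 z)
  · exact tendsto_nhds_unique (tendsto_finsetSum _ fun z _ => hμ0 z)
      (tendsto_const_nhds.congr' (eventually_mem_Ioo.mono fun ε hε => (hstat ε hε).2.1.symm))
  · exact tendsto_nhds_unique (tendsto_finsetSum _ fun z _ => (hμ0 z).mul (hP.tendsto z y))
      ((hμ0 y).congr' (eventually_mem_Ioo.mono fun ε hε => ((hstat ε hε).2.2 y).symm))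

omit [DecidableEq S] [Nonempty S] in
theorem IsLimitDistribution.eq {μ0 ν0 : S → ℝ} (hμ : IsLimitDistribution P μ0)
    (hν : IsLimitDistribution P ν0) : μ0 = ν0 := by
  obtain ⟨μ, h₁, h₂⟩ := hμ
  obtain ⟨ν, h₃, h₄⟩ := hν
  refine tendsto_nhds_unique h₂ (h₄.congr' (eventually_mem_Ioo.mono fun ε hε => ?_))
  exact (h₁ ε hε _).mp ((h₃ ε hε _).mpr rfl)

/-- If all tree weights are `O(ε ^ r)` and that of `s` is of order `ε ^ r`, then `s` is
stochastically stable, and so are no states of tree weight `O(ε ^ r')` with `r < r'`. -/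
theorem stable_of_treeWeight_bounds (hP : IsRegularPerturbation P0 P)
    (h : ∀ x y, IsPowerLike fun ε => P ε x y) {r C c : ℝ} (hc : 0 < c) {s : S}
    (hup : ∀ z, ∀ ε ∈ Ioo (0 : ℝ) 1, treeWeight (P ε) z ≤ C * ε ^ r)
    (hlow : ∀ᶠ ε in 𝓝[>] 0, c * ε ^ r ≤ treeWeight (P ε) s) :
    IsStochasticallyStable P s ∧ ∀ z r' C', r < r' →
      (∀ ε ∈ Ioo (0 : ℝ) 1, treeWeight (P ε) z ≤ C' * ε ^ r') →
      ¬ IsStochasticallyStable P z := by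
  obtain ⟨μ0, hμ0, -, hlim⟩ := exists_tendsto_treeWeight hP h
  have hT := isPowerLike_treeWeight h
  have hcard : (0 : ℝ) < Fintype.card S := by exact_mod_cast Fintype.card_pos
  have hsum (ε : ℝ) (hε : ε ∈ Ioo (0 : ℝ) 1) :
      ∑ x, treeWeight (P ε) x ≤ Fintype.card S * (C * ε ^ r) := by
    rw [← nsmul_eq_mul]
    exact Finset.sum_le_card_nsmul _ _ _ fun z _ => hup z ε hε
  have hle (ε : ℝ) (hε : ε ∈ Ioo (0 : ℝ) 1) : treeWeight (P ε) s ≤ ∑ x, treeWeight (P ε) x :=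
    Finset.single_le_sum (fun x _ => (hT x).nonneg hε) (Finset.mem_univ s)
  constructor
  · have hC : 0 < C := by
      obtain ⟨ε, h₁, h₂⟩ := (hlow.and eventually_mem_Ioo).exists
      have h₃ := mul_pos hc (Real.rpow_pos_of_pos h₂.1 r)
      exact pos_of_mul_pos_left (h₃.trans_le (h₁.trans (hup s ε h₂)))
        (Real.rpow_pos_of_pos h₂.1 r).le
    refine ⟨μ0, hμ0, (div_pos hc (mul_pos hcard hC)).trans_le (ge_of_tendsto (hlim s) ?_)⟩
    filter_upwards [hlow, eventually_mem_Ioo] with ε h₁ hε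
    have hr := Real.rpow_pos_of_pos hε.1 r
    rw [← mul_div_mul_right c _ hr.ne']
    refine div_le_div₀ ((mul_pos hc hr).le.trans h₁) h₁
      ((mul_pos hc hr).trans_le (h₁.trans (hle ε hε))) ?_
    rw [mul_assoc]
    exact hsum ε hε
  · rintro z r' C' hr hz ⟨ν0, hν0, hpos⟩
    rw [hν0.eq hμ0] at hpos
    refine hpos.not_ge (le_of_tendsto_of_tendsto (hlim z)
      (g := fun ε => C' / c * ε ^ (r' - r)) ?_ ?_)
    · simpa using (tendsto_rpow_zero (sub_pos.mpr hr)).const_mul (C' / c)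
    · filter_upwards [hlow, eventually_mem_Ioo] with ε h₁ hε
      have hr := Real.rpow_pos_of_pos hε.1 r
      calc treeWeight (P ε) z / ∑ x, treeWeight (P ε) x
          ≤ treeWeight (P ε) z / (c * ε ^ r) := by
            exact div_le_div_of_nonneg_left ((hT z).nonneg hε) (mul_pos hc hr)
              (h₁.trans (hle ε hε))
        _ ≤ C' * ε ^ r' / (c * ε ^ r) := div_le_div_of_nonneg_right (hz ε hε) (mul_pos hc hr).le
        _ = C' / c * ε ^ (r' - r) := by rw [mul_div_mul_comm, ← Real.rpow_sub hε.1]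

end Limit

end PerturbedChain

/-! ### One step as a finite sum over random draws -/

namespace MatchingPhase

variable {K M : ℕ}

namespace Game

open PerturbedChain

/-- The standing assumptions on the data of a matching phase. -/
structure IsAdmissible (G : Game K M) : Prop where
  lt : K < M
  κ_gt : (M : ℝ) < G.κ
  β_pos : 0 < G.β
  est_mem : ∀ k m, G.est k m ∈ Icc (0 : ℝ) 1
  q_nonneg : ∀ w, 0 ≤ G.q w
  q_sum : ∑ w, G.q w = 1
  q_pos : 0 < G.q (noAttack M)

/-- The random draws of one step: attack, actions, moods before and after synchronization. -/
abbrev Draw (K M : ℕ) := Attack M × (Fin K → Fin M) × (Fin K → Mood) × (Fin K → Mood)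

/-- A player in state `s` who plays `a` keeps the baseline action and utility. -/
abbrev Keeps (s : PlayerState M) (a : Fin M) : Prop := s.mood = .content ∧ a = s.act

variable (G : Game K M)

/-- The joint state after a step with draws `o`. -/
noncomputable def next (x : State K M) (o : Draw K M) : State K M := fun k =>
  ⟨o.2.1 k, if Keeps (x k) (o.2.1 k) then (x k).util else G.utility k o.2.1 o.1, o.2.2.2 k⟩

/-- The contribution of player `k` to the probability of the draws `o`. -/
noncomputable def playerWeight (ε : ℝ) (x : State K M) (o : Draw K M) (k : Fin K) : ℝ :=
  G.actionProb ε (x k) (o.2.1 k) *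
    moodProb ε (x k) (o.2.1 k) (G.utility k o.2.1 o.1) (o.2.2.1 k) *
    G.syncProb ε o.2.2.1 k (o.2.2.2 k)

/-- The probability of the draws `o` in state `x`. -/
noncomputable def weight (ε : ℝ) (x : State K M) (o : Draw K M) : ℝ :=
  G.q o.1 * ∏ k, G.playerWeight ε x o k

theorem updated_eq (s : PlayerState M) (a : Fin M) (u : ℝ) (m : Mood) :
    updated s a u m = ⟨a, if Keeps s a then s.util else u, m⟩ := by
  unfold updated
  split_ifs with h
  · rw [h.2]
  · rfl

-- Treating the final moods as a further draw makes the next state a function of the draws. Only the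
-- final moods of y contribute, so the extra sum has a single nonzero term. Resistances can then be
-- read off draw by draw.
open Classical in
theorem transition_eq (ε : ℝ) (x y : State K M) :
    G.transition ε x y = ∑ o : Draw K M, if G.next x o = y then G.weight ε x o else 0 := by
  have inner (w : Attack M) (a : Fin K → Fin M) (m : Fin K → Mood) :
      (∏ k, if (y k).act = (updated (x k) (a k) (G.utility k a w) (m k)).act ∧
          (y k).util = (updated (x k) (a k) (G.utility k a w) (m k)).util
        then G.syncProb ε m k (y k).mood else 0) =
      ∑ m' : Fin K → Mood, if G.next x (w, a, m, m') = y then ∏ k, G.syncProb ε m k (m' k)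
        else 0 := by
    rw [Finset.sum_eq_single fun k => (y k).mood]
    · simp only [updated_eq]
      split_ifs with h
      · refine Finset.prod_congr rfl fun k _ => if_pos ?_
        rw [← h]
        exact ⟨rfl, rfl⟩
      · rw [Finset.prod_eq_zero_iff]
        by_contra! hne
        refine h (funext fun k => ?_)
        have := (ite_ne_right_iff.mp (hne k (Finset.mem_univ k))).1
        exact PlayerState.ext this.1.symm this.2.symm rfl
    · intro m' _ hm'
      refine if_neg fun h => hm' ?_
      rw [← h]
      rfl
    · simp
  unfold transition
  simp only [inner, Fintype.sum_prod_type, Finset.mul_sum, weight, playerWeight,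
    Finset.prod_mul_distrib]
  refine Finset.sum_congr rfl fun w _ => Finset.sum_congr rfl fun a _ =>
    Finset.sum_congr rfl fun m _ => Finset.sum_congr rfl fun m' _ => ?_
  split_ifs
  · ring
  · simp

variable {G} (hG : G.IsAdmissible)

include hG

namespace IsAdmissible

theorem κ_pos : 0 < G.κ := (Nat.cast_nonneg M).trans_lt hG.κ_gt

theorem one_lt (k : Fin K) : (1 : ℝ) < M := by
  have h₁ := hG.lt
  have h₂ := k.pos
  exact_mod_cast (by omega : 1 < M)

theorem utility_mem (k : Fin K) (a : Fin K → Fin M) (w : Attack M) :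
    G.utility k a w ∈ Icc (0 : ℝ) 1 := by
  unfold utility
  split_ifs
  · exact hG.est_mem k (a k)
  · simp

theorem utility_le_noAttack (k : Fin K) (a : Fin K → Fin M) (w : Attack M) :
    G.utility k a w ≤ G.utility k a (noAttack M) := by
  unfold utility
  split_ifs with h₁ h₂ h₂
  · exact le_rfl
  · exact absurd ⟨h₁.1, rfl⟩ h₂
  · exact (hG.est_mem _ _).1
  · exact le_rfl

/-! ### The factors of the transition probabilities -/

theorem isPowerLike_actionProb (k : Fin K) (s : PlayerState M) (a : Fin M) :
    IsPowerLike fun ε => G.actionProb ε s a := by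
  have hM := hG.one_lt k
  unfold actionProb
  cases s.mood
  · dsimp only
    split_ifs
    · exact .one_sub_rpow hG.κ_pos.le
    · exact (IsPowerLike.rpow hG.κ_pos.le).mul (.const (inv_nonneg.mpr (sub_pos.mpr hM).le))
  · exact .const (one_div_nonneg.mpr (Nat.cast_nonneg M))

omit hG in
theorem isPowerLike_moodProb (s : PlayerState M) (a : Fin M) {u : ℝ} (hu : u ≤ 1) (m : Mood) :
    IsPowerLike fun ε => moodProb ε s a u m := by
  unfold moodProb
  split_ifs
  · exact .const zero_le_one
  · exact .zero
  · cases m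
    · exact .rpow (sub_nonneg.mpr hu)
    · exact .one_sub_rpow (sub_nonneg.mpr hu)

theorem isPowerLike_syncProb (m : Fin K → Mood) (k : Fin K) (m' : Mood) :
    IsPowerLike fun ε => G.syncProb ε m k m' := by
  unfold syncProb
  split_ifs
  · exact .const zero_le_one
  · exact .zero
  · cases m'
    · exact .rpow hG.β_pos.le
    · exact .one_sub_rpow hG.β_pos.le

theorem isPowerLike_weight (x : State K M) (o : Draw K M) :
    IsPowerLike fun ε => G.weight ε x o :=
  (IsPowerLike.const (hG.q_nonneg _)).mul (.prod fun k _ =>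
    ((hG.isPowerLike_actionProb k _ _).mul
      (isPowerLike_moodProb _ _ (hG.utility_mem _ _ _).2 _)).mul
      (hG.isPowerLike_syncProb _ _ _))

theorem isPowerLike_transition (x y : State K M) :
    IsPowerLike fun ε => G.transition ε x y := by
  classical
  simp only [transition_eq]
  refine .sum fun o _ => ?_
  split_ifs
  · exact hG.isPowerLike_weight x o
  · exact .zero

theorem weight_le_transition {ε : ℝ} (hε : ε ∈ Ioo (0 : ℝ) 1) (x : State K M) (o : Draw K M) :
    G.weight ε x o ≤ G.transition ε x (G.next x o) := by
  classical
  rw [transition_eq]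
  refine le_trans (by simp) (Finset.single_le_sum
    (f := fun o' => if G.next x o' = G.next x o then G.weight ε x o' else 0)
    (fun o' _ => ?_) (Finset.mem_univ o))
  split_ifs
  · exact (hG.isPowerLike_weight x o').nonneg hε
  · exact le_rfl

theorem exists_draw_of_transition_pos {ε : ℝ} (hε : ε ∈ Ioo (0 : ℝ) 1) {x y : State K M}
    (h : 0 < G.transition ε x y) : ∃ o, G.next x o = y ∧ 0 < G.weight ε x o := by
  classical
  rw [transition_eq] at h
  obtain ⟨o, -, ho⟩ := Finset.exists_ne_zero_of_sum_ne_zero h.ne'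
  obtain ⟨h₁, h₂⟩ := ite_ne_right_iff.mp ho
  exact ⟨o, h₁, ((hG.isPowerLike_weight x o).nonneg hε).lt_of_ne' h₂⟩

/-- All exponents are nonnegative because utilities are at most 1, so continuity includes ε = 0,
where exponent 0 gives the value 1. -/
theorem continuous_transition (x y : State K M) :
    Continuous fun ε => G.transition ε x y := by
  have h (r : ℝ) (hr : 0 ≤ r) := Real.continuous_rpow_const hr
  have hκ := h _ hG.κ_pos.le
  have hβ := h _ hG.β_pos.le
  classical
  simp only [transition_eq, weight, playerWeight]
  refine continuous_finsetSum _ fun o _ => ?_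
  split_ifs
  swap
  · exact continuous_const
  refine continuous_const.mul (continuous_finsetProd _ fun k _ => (Continuous.mul ?_ ?_).mul ?_)
  · unfold actionProb
    cases (x k).mood <;> dsimp only
    · split_ifs <;> fun_prop
    · fun_prop
  · have hu := h _ (sub_nonneg.mpr (hG.utility_mem k o.2.1 o.1).2)
    unfold moodProb
    split_ifs
    · fun_prop
    · fun_prop
    · cases o.2.2.1 k <;> dsimp only <;> fun_prop
  · unfold syncProb
    split_ifs
    · fun_prop
    · fun_prop
    · cases o.2.2.2 k <;> dsimp only <;> fun_prop

theorem sum_actionProb (ε : ℝ) (k : Fin K) (s : PlayerState M) : ∑ a, G.actionProb ε s a = 1 := by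
  have hM := hG.one_lt k
  unfold actionProb
  cases s.mood
  · dsimp only
    rw [← Finset.add_sum_erase _ _ (Finset.mem_univ s.act), if_pos rfl,
      Finset.sum_congr rfl fun a ha => if_neg (Finset.ne_of_mem_erase ha), Finset.sum_const,
      Finset.card_erase_of_mem (Finset.mem_univ _), Finset.card_univ, Fintype.card_fin,
      nsmul_eq_mul, Nat.cast_sub (by exact_mod_cast hM.le), Nat.cast_one,
      mul_div_cancel₀ _ (sub_pos.mpr hM).ne']
    ring
  · simp only [Finset.sum_const, Finset.card_univ, Fintype.card_fin, nsmul_eq_mul]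
    field_simp

omit hG in
theorem sum_mood (f : Mood → ℝ) : ∑ m, f m = f .content + f .discontent := by
  rw [show (Finset.univ : Finset Mood) = {.content, .discontent} from rfl]
  exact Finset.sum_pair (by decide)

omit hG in
theorem sum_moodProb (ε : ℝ) (s : PlayerState M) (a : Fin M) (u : ℝ) :
    ∑ m, moodProb ε s a u m = 1 := by
  rw [sum_mood]
  unfold moodProb
  split_ifs <;> simp_all

omit hG in
theorem sum_syncProb (ε : ℝ) (m : Fin K → Mood) (k : Fin K) : ∑ m', G.syncProb ε m k m' = 1 := by
  rw [sum_mood]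
  unfold syncProb
  split_ifs with h₁ h₂ h₃ h₃
  · rw [← h₂] at h₃; cases h₃
  · simp
  · simp
  · cases h : m k <;> simp_all
  · simp

theorem sum_weight (ε : ℝ) (x : State K M) : ∑ o, G.weight ε x o = 1 := by
  simp only [weight, playerWeight, Fintype.sum_prod_type, Finset.prod_mul_distrib,
    ← Finset.mul_sum]
  have h₁ (m : Fin K → Mood) : ∑ m' : Fin K → Mood, ∏ k, G.syncProb ε m k (m' k) = 1 := by
    rw [← Fintype.piFinset_univ, ← Finset.prod_univ_sum]
    exact Finset.prod_eq_one fun k _ => sum_syncProb ε m k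
  have h₂ (w : Attack M) (a : Fin K → Fin M) :
      ∑ m : Fin K → Mood, ∏ k, moodProb ε (x k) (a k) (G.utility k a w) (m k) = 1 := by
    rw [← Fintype.piFinset_univ, ← Finset.prod_univ_sum]
    exact Finset.prod_eq_one fun k _ => sum_moodProb ε _ _ _
  have h₃ : ∑ a : Fin K → Fin M, ∏ k, G.actionProb ε (x k) (a k) = 1 := by
    rw [← Fintype.piFinset_univ, ← Finset.prod_univ_sum]
    exact Finset.prod_eq_one fun k _ => hG.sum_actionProb ε k _
  simp only [h₁, mul_one, h₂, h₃, ← Finset.mul_sum, hG.q_sum]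

omit hG in
theorem enterable_of_transition_pos {ε : ℝ} (hε : ε ∈ Ioo (0 : ℝ) 1) {x y : State K M}
    (hx : G.Enterable x) (h : 0 < G.transition ε x y) : G.Enterable y := by
  obtain ⟨z₀, h₀, hz⟩ := hx
  exact ⟨z₀, h₀, hz.tail ⟨ε, hε, h⟩⟩

theorem isStochastic_chain {ε : ℝ} (hε : ε ∈ Ioo (0 : ℝ) 1) : IsStochastic (G.chain ε) := by
  classical
  refine ⟨fun x y => (hG.isPowerLike_transition x.1 y.1).nonneg hε, fun x => ?_⟩
  simp only [chain, transition_eq]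
  rw [Finset.sum_comm, ← hG.sum_weight ε x.1]
  refine Finset.sum_congr rfl fun o _ => ?_
  -- Restriction to enterable states loses no mass: draws of positive weight lead from enterable
  -- states to enterable states.
  rcases ((hG.isPowerLike_weight x.1 o).nonneg hε).eq_or_lt with h | h
  · simp [← h]
  · have hy := enterable_of_transition_pos hε x.2 (h.trans_le (hG.weight_le_transition hε x.1 o))
    rw [Finset.sum_eq_single ⟨G.next x.1 o, hy⟩ (fun y _ hne => if_neg fun h => hne
      (Subtype.ext h.symm)) (by simp), if_pos rfl]

end IsAdmissible

end Game

end MatchingPhase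

/-! ### Edges of known resistance and ergodicity of the chain -/

namespace MatchingPhase

variable {K M : ℕ}

namespace Game

open PerturbedChain

variable (G : Game K M)

/-- A transition from `x` to `y` along draws whose probability is of order `ε ^ r`. -/
def HasEdge (x y : State K M) (r : ℝ) : Prop :=
  ∃ o, G.next x o = y ∧ HasLeadingOrder (fun ε => G.weight ε x o) r

/-- The part of the resistance of a step that is due to content players who experiment. -/
noncomputable def deviationCost (x : State K M) (a : Fin K → Fin M) (k : Fin K) : ℝ :=
  if (x k).mood = .content ∧ a k ≠ (x k).act then G.κ else 0

variable {G} (hG : G.IsAdmissible)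

include hG

namespace IsAdmissible

/-! ### Transitions of prescribed resistance -/

theorem hasLeadingOrder_actionProb (x : State K M) (a : Fin K → Fin M) (k : Fin K) :
    HasLeadingOrder (fun ε => G.actionProb ε (x k) (a k)) (G.deviationCost x a k) := by
  have hM := hG.one_lt k
  unfold actionProb deviationCost
  cases (x k).mood
  · by_cases ha : a k = (x k).act
    · simpa [ha] using HasLeadingOrder.one_sub_rpow hG.κ_pos
    · simpa [ha, div_eq_mul_inv] using (HasLeadingOrder.rpow G.κ).mul
        (.const (inv_pos.mpr (sub_pos.mpr hM)))
  · simpa using HasLeadingOrder.const (inv_pos.mpr (one_pos.trans hM))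

omit hG in
theorem hasLeadingOrder_moodProb_content (s : PlayerState M) (a : Fin M) (u : ℝ) :
    HasLeadingOrder (fun ε => moodProb ε s a u .content) (if Keeps s a then 0 else 1 - u) := by
  unfold moodProb
  by_cases h : Keeps s a
  · simpa only [if_pos h, if_true] using HasLeadingOrder.const one_pos
  · simpa only [if_neg h] using HasLeadingOrder.rpow (1 - u)

omit hG in
theorem hasLeadingOrder_moodProb_discontent {s : PlayerState M} {a : Fin M} {u : ℝ}
    (h : ¬ Keeps s a) (hu : u < 1) :
    HasLeadingOrder (fun ε => moodProb ε s a u .discontent) 0 := by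
  unfold moodProb
  simp only [if_neg h]
  exact .one_sub_rpow (sub_pos.mpr hu)

theorem hasEdge_content (x : State K M) (a : Fin K → Fin M) {w : Attack M} (hw : 0 < G.q w) :
    G.HasEdge x
      (fun k => ⟨a k, if Keeps (x k) (a k) then (x k).util else G.utility k a w, .content⟩)
      (∑ k, (G.deviationCost x a k + if Keeps (x k) (a k) then 0 else 1 - G.utility k a w)) := by
  refine ⟨(w, a, fun _ => .content, fun _ => .content), rfl, ?_⟩
  have h := (HasLeadingOrder.const hw).mul (HasLeadingOrder.prod (t := Finset.univ) fun k _ =>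
    ((hG.hasLeadingOrder_actionProb x a k).mul
      (hasLeadingOrder_moodProb_content (x k) (a k) (G.utility k a w))).mul
      (HasLeadingOrder.const one_pos))
  simpa [weight, playerWeight, syncProb] using h

theorem hasEdge_discontent (x : State K M) (a : Fin K → Fin M) {w : Attack M} (hw : 0 < G.q w)
    {j : Fin K} (hj : ¬ Keeps (x j) (a j)) (hu : G.utility j a w < 1) :
    G.HasEdge x
      (fun k => ⟨a k, if Keeps (x k) (a k) then (x k).util else G.utility k a w, .discontent⟩)
      (∑ k, G.deviationCost x a k) := by
  -- Moods of order 0 before synchronization: a keeper is content for sure, and so is a player of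
  -- utility 1, as ε^0 = 1; the others draw discontent. Since j is discontent, synchronization makes
  -- everybody discontent at order 0.
  let m : Fin K → Mood := fun k =>
    if ¬ Keeps (x k) (a k) ∧ G.utility k a w < 1 then .discontent else .content
  have hmj : m j = .discontent := if_pos ⟨hj, hu⟩
  refine ⟨(w, a, m, fun _ => .discontent), rfl, ?_⟩
  have hm (k : Fin K) :
      HasLeadingOrder (fun ε => moodProb ε (x k) (a k) (G.utility k a w) (m k)) 0 := by
    by_cases h : ¬ Keeps (x k) (a k) ∧ G.utility k a w < 1
    · simp only [m, if_pos h]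
      exact hasLeadingOrder_moodProb_discontent h.1 h.2
    · simp only [m, if_neg h]
      convert hasLeadingOrder_moodProb_content (x k) (a k) (G.utility k a w) using 1
      split_ifs with h'
      · rfl
      · rw [(hG.utility_mem k a w).2.antisymm (not_lt.mp fun h'' => h ⟨h', h''⟩), sub_self]
  have hs (k : Fin K) : HasLeadingOrder (fun ε => G.syncProb ε m k .discontent) 0 := by
    have hall : ¬ ∀ i, m i = .content := fun h => by simpa [hmj] using h j
    unfold syncProb
    cases hk : m k
    · simpa [hall] using HasLeadingOrder.one_sub_rpow hG.β_pos
    · simpa using HasLeadingOrder.const one_pos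
  have h := (HasLeadingOrder.const hw).mul (HasLeadingOrder.prod (t := Finset.univ) fun k _ =>
    ((hG.hasLeadingOrder_actionProb x a k).mul (hm k)).mul (hs k))
  simpa [weight, playerWeight] using h

/-- A leading order gives positivity for some small ε, and positivity of a power-like function does
not depend on ε. -/
theorem weight_pos_of_hasLeadingOrder {x : State K M} {o : Draw K M} {r : ℝ}
    (h : HasLeadingOrder (fun ε => G.weight ε x o) r) {ε : ℝ} (hε : ε ∈ Ioo (0 : ℝ) 1) :
    0 < G.weight ε x o := by
  obtain ⟨c, hc, hle⟩ := h.exists_le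
  obtain ⟨ε', h₁, h₂⟩ := (hle.and eventually_mem_Ioo).exists
  exact (hG.isPowerLike_weight x o).pos_of_pos h₂
    ((mul_pos hc (Real.rpow_pos_of_pos h₂.1 r)).trans_le h₁) hε

theorem transition_pos_of_hasEdge {x y : State K M} {r : ℝ} (h : G.HasEdge x y r) {ε : ℝ}
    (hε : ε ∈ Ioo (0 : ℝ) 1) : 0 < G.transition ε x y := by
  obtain ⟨o, rfl, ho⟩ := h
  exact (hG.weight_pos_of_hasLeadingOrder ho hε).trans_le (hG.weight_le_transition hε x o)

theorem enterable_of_hasEdge {x y : State K M} {r : ℝ} (h : G.HasEdge x y r)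
    (hx : G.Enterable x) : G.Enterable y :=
  have hε : (1 / 2 : ℝ) ∈ Ioo (0 : ℝ) 1 := by constructor <;> norm_num
  enterable_of_transition_pos hε hx (hG.transition_pos_of_hasEdge h hε)

theorem enterable_of_hasEdge_of_isInitial {x y : State K M} {r : ℝ} (h : G.HasEdge x y r)
    (hx : IsInitial x) : G.Enterable y :=
  have hε : (1 / 2 : ℝ) ∈ Ioo (0 : ℝ) 1 := by constructor <;> norm_num
  ⟨x, hx, .single ⟨_, hε, hG.transition_pos_of_hasEdge h hε⟩⟩

/-! ### Irreducibility and aperiodicity -/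

omit hG in
theorem utility_eq_zero {i j : Fin K} (hij : i ≠ j) {a : Fin K → Fin M} (h : a i = a j)
    (w : Attack M) : G.utility i a w = 0 := by
  refine if_neg fun h' => ?_
  obtain ⟨s, hs⟩ := Finset.card_eq_one.mp h'.1
  have hi : i ∈ ({s} : Finset (Fin K)) := hs ▸ by simp
  have hj : j ∈ ({s} : Finset (Fin K)) := hs ▸ by simp [h]
  exact hij ((Finset.mem_singleton.mp hi).trans (Finset.mem_singleton.mp hj).symm)

theorem exists_ne (k : Fin K) (m : Fin M) : ∃ c, c ≠ m := by
  have h := hG.one_lt k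
  have : Nontrivial (Fin M) := Fin.nontrivial_iff_two_le.mpr (by exact_mod_cast h)
  exact _root_.exists_ne m

theorem actionProb_pos (k : Fin K) (s : PlayerState M) (a : Fin M) {ε : ℝ}
    (hε : ε ∈ Ioo (0 : ℝ) 1) : 0 < G.actionProb ε s a := by
  have hM := hG.one_lt k
  have h₁ := Real.rpow_pos_of_pos hε.1 G.κ
  have h₂ := Real.rpow_lt_one hε.1.le hε.2 hG.κ_pos
  unfold actionProb
  cases s.mood
  · dsimp only
    split_ifs
    · exact sub_pos.mpr h₂
    · exact div_pos h₁ (sub_pos.mpr hM)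
  · exact one_div_pos.mpr (one_pos.trans hM)

/-- If nobody keeps the old state, the support of a step does not depend on the old state. -/
theorem transition_pos_of_not_keeps {x z : State K M} {o : Draw K M}
    (hx : ∀ k, ¬ Keeps (x k) (o.2.1 k)) (hz : ∀ k, ¬ Keeps (z k) (o.2.1 k)) {ε : ℝ}
    (hε : ε ∈ Ioo (0 : ℝ) 1) (h : 0 < G.weight ε z o) :
    0 < G.transition ε x (G.next z o) := by
  have hnext : G.next x o = G.next z o := funext fun k => by
    unfold next
    rw [if_neg (hx k), if_neg (hz k)]
  rw [← hnext]
  refine lt_of_lt_of_le ?_ (hG.weight_le_transition hε x o)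
  refine ((hG.isPowerLike_weight x o).nonneg hε).lt_of_ne' ?_
  have h₁ := h.ne'
  simp only [weight, playerWeight, mul_ne_zero_iff, Finset.prod_ne_zero_iff] at h₁ ⊢
  refine ⟨h₁.1, fun k hk => ⟨⟨(hG.actionProb_pos k _ _ hε).ne', ?_⟩, (h₁.2 k hk).2⟩⟩
  have h₂ := (h₁.2 k hk).1.2
  simp only [moodProb, if_neg (hx k), if_neg (hz k)] at h₂ ⊢
  exact h₂

/-- Every state leads to everything that an initial state can enter in one step. -/
theorem reflTransGen_of_isInitial {ε : ℝ} (hε : ε ∈ Ioo (0 : ℝ) 1) (x : State K M)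
    {z y : State K M} (hz : IsInitial z) (hzy : 0 < G.transition ε z y) :
    Relation.ReflTransGen (fun x y => 0 < G.transition ε x y) x y := by
  obtain ⟨o, rfl, ho⟩ := hG.exists_draw_of_transition_pos hε hzy
  have hzo (k : Fin K) : ¬ Keeps (z k) (o.2.1 k) := by simp [Keeps, (hz k).2]
  have hstep (x : State K M) (hx : ∀ k, ¬ Keeps (x k) (o.2.1 k)) :
      0 < G.transition ε x (G.next z o) := hG.transition_pos_of_not_keeps hx hzo hε ho
  by_cases h : ∀ k, ¬ Keeps (x k) (o.2.1 k)
  · exact .single (hstep x h)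
  push Not at h
  obtain ⟨i, hi⟩ := h
  obtain ⟨c, hc⟩ := hG.exists_ne i (x i).act
  -- With a second player, all can collide on c and turn discontent. A lone player moves to c ≠
  -- o.2.1 i instead, so that in the following step the old state is not kept.
  by_cases hj : ∃ j, j ≠ i
  · obtain ⟨j, hj⟩ := hj
    have hu := utility_eq_zero (G := G) (a := fun _ => c) hj.symm rfl (noAttack M)
    have h₁ := hG.transition_pos_of_hasEdge (hG.hasEdge_discontent x (fun _ => c) hG.q_pos
      (j := i) (fun h => hc h.2) (by rw [hu]; exact one_pos)) hε
    exact .head h₁ (.single (hstep _ fun k h => by cases h.1))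
  · push Not at hj
    have h₁ := hG.transition_pos_of_hasEdge (hG.hasEdge_content x (fun _ => c) hG.q_pos) hε
    exact .head h₁ (.single (hstep _ fun k h => hc (by rw [← hi.2, ← hj k]; exact h.2.symm)))

omit hG in
theorem reflTransGen_chain {ε : ℝ} (hε : ε ∈ Ioo (0 : ℝ) 1) (x : G.Reach) {y : State K M}
    (h : Relation.ReflTransGen (fun x y => 0 < G.transition ε x y) x.1 y) :
    ∃ hy, Relation.ReflTransGen (fun x y => 0 < G.chain ε x y) x ⟨y, hy⟩ := by
  induction h with
  | refl => exact ⟨x.2, .refl⟩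
  | tail _ h ih =>
    obtain ⟨hy, ih⟩ := ih
    exact ⟨enterable_of_transition_pos hε hy h, ih.tail h⟩

theorem isIrreducible_chain {ε : ℝ} (hε : ε ∈ Ioo (0 : ℝ) 1) : IsIrreducible (G.chain ε) := by
  rw [isIrreducible_iff_reflTransGen (hG.isStochastic_chain hε).1]
  rintro x ⟨y, hy⟩
  have hε' {x y : State K M} (h : ∃ ε ∈ Ioo (0 : ℝ) 1, 0 < G.transition ε x y) :
      0 < G.transition ε x y := by
    obtain ⟨ε', h₁, h₂⟩ := h
    exact (hG.isPowerLike_transition x y).pos_of_pos h₁ h₂ hε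
  obtain ⟨z, hz, h⟩ := id hy
  obtain ⟨c, hzc, hcy⟩ := Relation.TransGen.head'_iff.mp h
  exact (reflTransGen_chain hε x ((hG.reflTransGen_of_isInitial hε x.1 hz (hε' hzc)).trans
    (Relation.ReflTransGen.mono (fun _ _ => hε') _ _ hcy))).2

theorem exists_isInitial : ∃ z : State K M, IsInitial z :=
  ⟨fun _ => ⟨⟨0, (Nat.zero_le K).trans_lt hG.lt⟩, 0, .discontent⟩, fun _ => ⟨rfl, rfl⟩⟩

theorem enterable_of_aligned {z : State K M} {w : Attack M} (hw : 0 < G.q w)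
    (hz : ∀ k, (z k).mood = .content ∧ (z k).util = G.utility k (profile z) w) :
    G.Enterable z := by
  obtain ⟨z₀, h₀⟩ := hG.exists_isInitial
  convert hG.enterable_of_hasEdge_of_isInitial (hG.hasEdge_content z₀ (profile z) hw) h₀ using 1
  funext k
  exact PlayerState.ext rfl (by simp [Keeps, (h₀ k).2, (hz k).2]) (hz k).1

theorem exists_content : ∃ z : G.Reach, ∀ k, (z.1 k).mood = .content := by
  let a : Fin K → Fin M := fun _ => ⟨0, (Nat.zero_le K).trans_lt hG.lt⟩
  let z : State K M := fun k => ⟨a k, G.utility k a (noAttack M), .content⟩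
  exact ⟨⟨z, hG.enterable_of_aligned hG.q_pos fun _ => ⟨rfl, rfl⟩⟩, fun _ => rfl⟩

theorem nonempty_reach : Nonempty G.Reach := hG.exists_content.nonempty

theorem isErgodic_chain {ε : ℝ} (hε : ε ∈ Ioo (0 : ℝ) 1) : IsErgodic (G.chain ε) := by
  have hP := hG.isStochastic_chain hε
  have hirr := hG.isIrreducible_chain hε
  refine ⟨hP, hirr, ?_⟩
  obtain ⟨z, hz⟩ := hG.exists_content
  refine hirr.isAperiodic hP.1 (s := z) ?_
  -- An all-content state has a self-loop: everybody repeats the baseline action.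
  have h := hG.transition_pos_of_hasEdge (hG.hasEdge_content z.1 (profile z.1) hG.q_pos) hε
  convert h using 1
  unfold chain
  congr 1
  funext k
  exact PlayerState.ext rfl (by simp [Keeps, profile, hz k]) (hz k)

theorem isRegularPerturbation : IsRegularPerturbation (G.chain 0) G.chain where
  ergodic _ hε := hG.isErgodic_chain hε
  tendsto x y := ((hG.continuous_transition x.1 y.1).tendsto 0).mono_left nhdsWithin_le_nhds
  resistance x y := by
    rintro ⟨ε, hε, h⟩
    rcases hG.isPowerLike_transition x.1 y.1 with h₀ | ⟨-, r, hr, h₀⟩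
    · exact absurd (h₀ ε hε) h.ne'
    · exact ⟨r, hr, h₀⟩

end IsAdmissible

end Game

end MatchingPhase

/-! ### The potential `shortfall` and upper bounds for tree weights -/

namespace MatchingPhase

variable {K M : ℕ}

namespace Game

open PerturbedChain

/-- Shortfall of the baseline utilities of the content players. -/
noncomputable def shortfall (x : State K M) : ℝ :=
  ∑ k, if (x k).mood = .content then 1 - (x k).util else 0

variable (G : Game K M)

open Classical in
/-- The resistance of leaving a state: `κ` if everybody is content and `0` otherwise. -/
noncomputable def exitCost (x : State K M) : ℝ :=
  if ∀ k, (x k).mood = .content then G.κ else 0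

variable {G}

theorem shortfall_of_content {x : State K M} (h : ∀ k, (x k).mood = .content) :
    shortfall x = K - ∑ k, (x k).util := by
  simp [shortfall, h]

theorem shortfall_of_discontent {x : State K M} (h : ∀ k, (x k).mood = .discontent) :
    shortfall x = 0 := by
  simp [shortfall, h]

variable (hG : G.IsAdmissible)

include hG

namespace IsAdmissible

/-! ### Invariants of the enterable states -/

/-- A refreshed utility is 0 in a collision, so two positive baselines on one arm would both have to
be kept, which the old state excludes. Kept utilities may be outdated, so only an upper bound by the
estimate persists. -/
theorem invariant_next {x : State K M} (o : Draw K M)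
    (hx : (∀ k, (x k).util ∈ Icc 0 (G.est k (x k).act)) ∧
      ∀ i j, i ≠ j → 0 < (x i).util → 0 < (x j).util → (x i).act ≠ (x j).act) :
    (∀ k, (G.next x o k).util ∈ Icc 0 (G.est k (G.next x o k).act)) ∧
      ∀ i j, i ≠ j → 0 < (G.next x o i).util → 0 < (G.next x o j).util →
        (G.next x o i).act ≠ (G.next x o j).act := by
  have hu (i j : Fin K) (hij : i ≠ j) (h : o.2.1 i = o.2.1 j)
      (hi : ¬ Keeps (x i) (o.2.1 i)) : (G.next x o i).util = 0 := by
    simp only [next, if_neg hi]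
    exact utility_eq_zero hij h _
  refine ⟨fun k => ?_, fun i j hij hi hj h => ?_⟩
  · by_cases hk : Keeps (x k) (o.2.1 k)
    · simp only [next, if_pos hk]
      rw [hk.2]
      exact hx.1 k
    · simp only [next, if_neg hk]
      unfold utility
      split_ifs
      · exact ⟨(hG.est_mem _ _).1, le_rfl⟩
      · exact ⟨le_rfl, (hG.est_mem _ _).1⟩
  · by_cases hi' : Keeps (x i) (o.2.1 i)
    · by_cases hj' : Keeps (x j) (o.2.1 j)
      · simp only [next, if_pos hi', if_pos hj'] at hi hj h
        exact hx.2 i j hij hi hj (hi'.2 ▸ hj'.2 ▸ h)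
      · exact hj.ne' (hu j i hij.symm h.symm hj')
    · exact hi.ne' (hu i j hij h hi')

theorem invariant_of_enterable {x : State K M} (h : G.Enterable x) :
    (∀ k, (x k).util ∈ Icc 0 (G.est k (x k).act)) ∧
      ∀ i j, i ≠ j → 0 < (x i).util → 0 < (x j).util → (x i).act ≠ (x j).act := by
  obtain ⟨z, hz, h⟩ := h
  induction h with
  | single h =>
    obtain ⟨ε, hε, h⟩ := h
    obtain ⟨o, rfl, -⟩ := hG.exists_draw_of_transition_pos hε h
    refine hG.invariant_next o ⟨fun k => ?_, fun i j _ hi => absurd hi ?_⟩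
    · rw [(hz k).1]
      exact ⟨le_rfl, (hG.est_mem _ _).1⟩
    · rw [(hz i).1]
      exact lt_irrefl _
  | tail _ h ih =>
    obtain ⟨ε, hε, h⟩ := h
    obtain ⟨o, rfl, -⟩ := hG.exists_draw_of_transition_pos hε h
    exact hG.invariant_next o ih

theorem util_le_one {x : State K M} (h : G.Enterable x) (k : Fin K) : (x k).util ≤ 1 :=
  ((hG.invariant_of_enterable h).1 k).2.trans (hG.est_mem _ _).2

/-- The baseline utilities of an enterable state do not exceed the maximal welfare, even if they
are outdated. -/
theorem sum_util_le {x : State K M} (h : G.Enterable x) {W : ℝ}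
    (hW : ∀ a : Fin K → Fin M, ∑ k, G.utility k a (noAttack M) ≤ W) :
    ∑ k, (x k).util ≤ W := by
  classical
  obtain ⟨h₁, h₂⟩ := hG.invariant_of_enterable h
  obtain ⟨c, hc⟩ : ∃ c, ∀ k, (x k).act ≠ c := by
    by_contra! hsurj
    have := Fintype.card_le_of_surjective _ hsurj
    simp only [Fintype.card_fin] at this
    exact this.not_gt hG.lt
  -- Players without positive baseline utility move to the arm c, which is nobody's baseline since K
  -- < M. The others are then alone on their arms and earn at least their baselines.
  let a : Fin K → Fin M := fun k => if 0 < (x k).util then (x k).act else c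
  refine le_trans (Finset.sum_le_sum fun k _ => ?_) (hW a)
  by_cases hk : 0 < (x k).util
  · have hak : a k = (x k).act := if_pos hk
    have hload : load a (a k) = 1 := by
      refine Finset.card_eq_one.mpr ⟨k, Finset.ext fun j => ?_⟩
      simp only [Finset.mem_filter, Finset.mem_univ, true_and, Finset.mem_singleton]
      refine ⟨fun hj => ?_, fun hj => by rw [hj]⟩
      by_contra hjk
      rw [hak] at hj
      by_cases hj' : 0 < (x j).util
      · simp only [a, if_pos hj'] at hj
        exact h₂ j k hjk hj' hk hj
      · simp only [a, if_neg hj'] at hj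
        exact hc k hj.symm
    rw [utility, if_pos ⟨hload, rfl⟩, hak]
    exact (h₁ k).2
  · exact (not_lt.mp hk).trans (hG.utility_mem _ _ _).1

theorem exists_shortfall_eq_zero : ∃ x : G.Reach, shortfall x.1 = 0 := by
  obtain ⟨z, hz⟩ := hG.exists_isInitial
  let a : Fin K → Fin M := fun _ => ⟨0, (Nat.zero_le K).trans_lt hG.lt⟩
  have hzk (k : Fin K) : ¬ Keeps (z k) (a k) := by simp [Keeps, (hz k).2]
  by_cases h : ∃ k, G.utility k a (noAttack M) < 1
  · obtain ⟨k, hk⟩ := h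
    exact ⟨⟨_, hG.enterable_of_hasEdge_of_isInitial
      (hG.hasEdge_discontent z a hG.q_pos (hzk k) hk) hz⟩, shortfall_of_discontent fun _ => rfl⟩
  · push Not at h
    refine ⟨⟨_, hG.enterable_of_hasEdge_of_isInitial (hG.hasEdge_content z a hG.q_pos) hz⟩,
      Finset.sum_eq_zero fun k _ => ?_⟩
    simp only [if_true, if_neg (hzk k), sub_eq_zero]
    exact (h k).antisymm (hG.utility_mem _ _ _).2

/-! ### Lower bounds for resistances -/

theorem actionProb_le (x : State K M) (a : Fin K → Fin M) (k : Fin K) {ε : ℝ}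
    (hε : ε ∈ Ioo (0 : ℝ) 1) :
    G.actionProb ε (x k) (a k) ≤ ε ^ G.deviationCost x a k := by
  have hM : (2 : ℝ) ≤ M := by
    have := hG.one_lt k
    exact_mod_cast (by exact_mod_cast this : 1 < M)
  have h₁ := Real.rpow_pos_of_pos hε.1 G.κ
  unfold actionProb deviationCost
  cases (x k).mood
  · by_cases ha : a k = (x k).act
    · simp [ha, h₁.le]
    · simpa [ha] using div_le_self h₁.le (by linarith : (1 : ℝ) ≤ M - 1)
  · simpa using inv_le_one_of_one_le₀ (by linarith : (1 : ℝ) ≤ M)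

omit hG in
theorem moodProb_le (s : PlayerState M) (a : Fin M) {u : ℝ} (m : Mood) {ε : ℝ}
    (hε : ε ∈ Ioo (0 : ℝ) 1) :
    moodProb ε s a u m ≤ ε ^ (if ¬ Keeps s a ∧ m = .content then 1 - u else 0) := by
  have h₁ := Real.rpow_pos_of_pos hε.1 (1 - u)
  unfold moodProb
  by_cases h : Keeps s a
  · rw [if_pos h]
    split_ifs <;> simp_all
  · rw [if_neg h]
    cases m
    · rw [if_pos ⟨h, rfl⟩]
    · simp [h₁.le]

theorem syncProb_le_one (m : Fin K → Mood) (k : Fin K) (m' : Mood) {ε : ℝ}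
    (hε : ε ∈ Ioo (0 : ℝ) 1) : G.syncProb ε m k m' ≤ 1 := by
  rw [← sum_syncProb (G := G) ε m k]
  exact Finset.single_le_sum (fun m' _ => (hG.isPowerLike_syncProb m k m').nonneg hε)
    (Finset.mem_univ m')

/-- Synchronization never turns a discontent player content, so the cost 1 - u of becoming content
can be charged to the final mood. -/
theorem playerWeight_le (x : State K M) (o : Draw K M) (k : Fin K) {ε : ℝ}
    (hε : ε ∈ Ioo (0 : ℝ) 1) :
    G.playerWeight ε x o k ≤ ε ^ (G.deviationCost x o.2.1 k +
      if ¬ Keeps (x k) (o.2.1 k) ∧ o.2.2.2 k = .content then 1 - G.utility k o.2.1 o.1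
        else 0) := by
  have hpos (r : ℝ) : 0 < ε ^ r := Real.rpow_pos_of_pos hε.1 r
  have hm := (isPowerLike_moodProb (x k) (o.2.1 k) (hG.utility_mem k o.2.1 o.1).2
    (o.2.2.1 k)).nonneg hε
  rw [Real.rpow_add hε.1]
  by_cases h : o.2.2.1 k = .discontent ∧ o.2.2.2 k = .content
  · have : G.syncProb ε o.2.2.1 k (o.2.2.2 k) = 0 := by simp [syncProb, h]
    rw [playerWeight, this, mul_zero]
    exact (mul_pos (hpos _) (hpos _)).le
  · have h₁ := hG.actionProb_le x o.2.1 k hε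
    have h₂ := moodProb_le (x k) (o.2.1 k) (u := G.utility k o.2.1 o.1) (o.2.2.1 k) hε
    have h₃ : ε ^ (if ¬ Keeps (x k) (o.2.1 k) ∧ o.2.2.1 k = .content
          then 1 - G.utility k o.2.1 o.1 else 0) ≤
        ε ^ (if ¬ Keeps (x k) (o.2.1 k) ∧ o.2.2.2 k = .content
          then 1 - G.utility k o.2.1 o.1 else 0) := by
      refine Real.rpow_le_rpow_of_exponent_ge hε.1 hε.2.le ?_
      have hu := (hG.utility_mem k o.2.1 o.1).2
      have h₄ : o.2.2.2 k = .content → o.2.2.1 k = .content := fun h' => by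
        cases h'' : o.2.2.1 k
        · rfl
        · exact absurd ⟨h'', h'⟩ h
      split_ifs with h₅ h₆ h₆
      · exact le_rfl
      · exact absurd ⟨h₅.1, h₄ h₅.2⟩ h₆
      · exact sub_nonneg.mpr hu
      · exact le_rfl
    calc G.playerWeight ε x o k
        ≤ G.actionProb ε (x k) (o.2.1 k) *
          moodProb ε (x k) (o.2.1 k) (G.utility k o.2.1 o.1) (o.2.2.1 k) :=
          mul_le_of_le_one_right (mul_nonneg ((hG.isPowerLike_actionProb k _ _).nonneg hε) hm)
            (hG.syncProb_le_one _ _ _ hε)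
      _ ≤ _ := mul_le_mul h₁ (h₂.trans h₃) hm (hpos _).le

/-- If everybody is content and nobody experiments, the state does not change, so leaving it costs
κ. The shortfall of a keeper cannot grow, and a player who becomes content after an update pays
exactly the new shortfall. -/
theorem le_deviationCost_add {x : State K M} (hx : G.Enterable x) {o : Draw K M}
    (hne : x ≠ G.next x o) {ε : ℝ} (hw : G.weight ε x o ≠ 0) :
    G.exitCost x + max 0 (shortfall (G.next x o) - shortfall x) ≤
      ∑ k, (G.deviationCost x o.2.1 k +
        if ¬ Keeps (x k) (o.2.1 k) ∧ o.2.2.2 k = .content then 1 - G.utility k o.2.1 o.1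
          else 0) := by
  have hdev (k : Fin K) : 0 ≤ G.deviationCost x o.2.1 k := by
    unfold deviationCost
    split_ifs
    · exact hG.κ_pos.le
    · exact le_rfl
  rw [Finset.sum_add_distrib]
  refine add_le_add ?_ (max_le (Finset.sum_nonneg fun k _ => ?_) ?_)
  · unfold exitCost
    split_ifs with hc
    · obtain ⟨k, hk⟩ : ∃ k, o.2.1 k ≠ (x k).act := by
        by_contra! ha
        simp only [weight, playerWeight, mul_ne_zero_iff, Finset.prod_ne_zero_iff] at hw
        have hkeep (k : Fin K) : Keeps (x k) (o.2.1 k) := ⟨hc k, ha k⟩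
        have hm (k : Fin K) : o.2.2.1 k = .content := by
          have h := (hw.2 k (Finset.mem_univ k)).1.2
          unfold moodProb at h
          rw [if_pos (hkeep k)] at h
          exact (ite_ne_right_iff.mp h).1
        have hm' (k : Fin K) : o.2.2.2 k = .content := by
          have h := (hw.2 k (Finset.mem_univ k)).2
          unfold syncProb at h
          rw [if_pos (Or.inr hm)] at h
          rw [(ite_ne_right_iff.mp h).1, hm k]
        refine hne (funext fun k => ?_)
        simp only [next, if_pos (hkeep k)]
        exact PlayerState.ext (ha k).symm rfl ((hc k).trans (hm' k).symm)
      calc G.κ = G.deviationCost x o.2.1 k := (if_pos ⟨hc k, hk⟩).symm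
        _ ≤ _ := Finset.single_le_sum (fun k _ => hdev k) (Finset.mem_univ k)
    · exact Finset.sum_nonneg fun k _ => hdev k
  · have := (hG.utility_mem k o.2.1 o.1).2
    split_ifs
    · exact sub_nonneg.mpr this
    · exact le_rfl
  · rw [shortfall, shortfall, ← Finset.sum_sub_distrib]
    refine Finset.sum_le_sum fun k _ => ?_
    have h₁ := hG.util_le_one hx k
    have hm : (G.next x o k).mood = o.2.2.2 k := rfl
    by_cases hk : Keeps (x k) (o.2.1 k)
    · have hu : (G.next x o k).util = (x k).util := if_pos hk
      have hkeep : ¬(¬ Keeps (x k) (o.2.1 k) ∧ o.2.2.2 k = .content) := fun h => h.1 hk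
      rw [hu, hm, if_pos hk.1, if_neg hkeep]
      split_ifs <;> linarith
    · have hu : (G.next x o k).util = G.utility k o.2.1 o.1 := if_neg hk
      rw [hu, hm]
      by_cases h : o.2.2.2 k = .content
      · have h' : ¬ Keeps (x k) (o.2.1 k) ∧ o.2.2.2 k = .content := ⟨hk, h⟩
        rw [if_pos h, if_pos h']
        split_ifs <;> linarith
      · have h' : ¬(¬ Keeps (x k) (o.2.1 k) ∧ o.2.2.2 k = .content) := fun h' => h h'.2
        rw [if_neg h, if_neg h']
        split_ifs <;> linarith

theorem transition_le {x y : State K M} (hx : G.Enterable x) (hne : x ≠ y) {ε : ℝ}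
    (hε : ε ∈ Ioo (0 : ℝ) 1) :
    G.transition ε x y ≤ Fintype.card (Draw K M) *
      ε ^ (G.exitCost x + max 0 (shortfall y - shortfall x)) := by
  classical
  rw [transition_eq, ← nsmul_eq_mul, ← Finset.card_univ]
  refine Finset.sum_le_card_nsmul _ _ _ fun o _ => ?_
  have hpos (r : ℝ) : 0 ≤ ε ^ r := Real.rpow_nonneg hε.1.le r
  split_ifs with ho
  swap
  · exact hpos _
  subst ho
  by_cases hw : G.weight ε x o = 0
  · rw [hw]
    exact hpos _
  have hq : G.q o.1 ≤ 1 := by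
    rw [← hG.q_sum]
    exact Finset.single_le_sum (fun w _ => hG.q_nonneg w) (Finset.mem_univ _)
  have hp (k : Fin K) : 0 ≤ G.playerWeight ε x o k :=
    mul_nonneg (mul_nonneg ((hG.isPowerLike_actionProb k _ _).nonneg hε)
      ((isPowerLike_moodProb _ _ (hG.utility_mem _ _ _).2 _).nonneg hε))
      ((hG.isPowerLike_syncProb _ _ _).nonneg hε)
  calc G.weight ε x o ≤ ∏ k, G.playerWeight ε x o k :=
        mul_le_of_le_one_left (Finset.prod_nonneg fun k _ => hp k) hq
    _ ≤ ∏ k, ε ^ _ := Finset.prod_le_prod (fun k _ => hp k) fun k _ => hG.playerWeight_le x o k hε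
    _ = ε ^ ∑ k, _ := (Real.rpow_sum_of_pos hε.1 _ _).symm
    _ ≤ _ := Real.rpow_le_rpow_of_exponent_ge hε.1 hε.2.le (hG.le_deviationCost_add hx hne hw)

open Classical in
theorem treeWeight_chain_le : ∃ C : ℝ, 0 ≤ C ∧ ∀ s z : G.Reach, ∀ ε ∈ Ioo (0 : ℝ) 1,
    treeWeight (G.chain ε) z ≤
      C * ε ^ (∑ x ∈ Finset.univ.erase z, G.exitCost x.1 + (shortfall z.1 - shortfall s.1)) :=
  ⟨_, mul_nonneg (Nat.cast_nonneg _) (pow_nonneg (Nat.cast_nonneg _) _),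
    fun s z _ hε => treeWeight_le (b := fun x : G.Reach => G.exitCost x.1)
    (φ := fun x => shortfall x.1) hε (Nat.cast_nonneg (Fintype.card (Draw K M)))
    (hG.isStochastic_chain hε).1
    (fun x _ hne => hG.transition_le x.2 (fun h => hne (Subtype.ext h)) hε) s z⟩

end IsAdmissible

end Game

end MatchingPhase

/-! ### Optimal trees and stochastic stability -/

namespace MatchingPhase

variable {K M : ℕ}

namespace Game

open PerturbedChain

variable {G : Game K M} (hG : G.IsAdmissible)

theorem deviationCost_eq_zero {x : State K M} {a : Fin K → Fin M} {k : Fin K}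
    (h : (x k).mood = .content → a k = (x k).act) : G.deviationCost x a k = 0 :=
  if_neg fun h' => h'.2 (h h'.1)

include hG

namespace IsAdmissible

/-! ### Paths of small resistance -/

/-- Discontent players choose arms for free: they crowd onto the arm of a content player, get
utility 0, and the discontent spreads at order 0. -/
theorem hasEdge_of_mixed {x : State K M} {i j : Fin K} (hi : (x i).mood = .content)
    (hj : (x j).mood = .discontent) :
    ∃ y, G.HasEdge x y 0 ∧ ∀ k, (y k).mood = .discontent := by
  let a : Fin K → Fin M := fun k => if (x k).mood = .content then (x k).act else (x i).act
  have hij : j ≠ i := by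
    rintro rfl
    rw [hi] at hj
    cases hj
  have hu : G.utility j a (noAttack M) = 0 := utility_eq_zero hij (by simp [a, hj]) _
  have h := hG.hasEdge_discontent x a hG.q_pos (j := j) (by simp [Keeps, hj])
    (by rw [hu]; exact one_pos)
  have h₀ : ∑ k, G.deviationCost x a k = 0 :=
    Finset.sum_eq_zero fun k _ => deviationCost_eq_zero fun h => if_pos h
  rw [h₀] at h
  exact ⟨_, h, fun _ => rfl⟩

omit hG in
theorem sum_deviationCost_update {x : State K M} (hx : ∀ k, (x k).mood = .content) {k : Fin K}
    {c : Fin M} (hc : c ≠ (x k).act) :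
    ∑ i, G.deviationCost x (Function.update (profile x) k c) i = G.κ := by
  rw [Finset.sum_eq_single k (fun i _ hi => deviationCost_eq_zero fun _ => by
    simp [hi, profile]) (by simp)]
  exact if_pos ⟨hx k, by simpa using hc⟩

/-- A single experiment either makes everybody discontent or has perfect success. -/
theorem hasEdge_of_deviation {x : State K M} (hx : ∀ k, (x k).mood = .content) {k : Fin K}
    {c : Fin M} (hc : c ≠ (x k).act) :
    (∃ y, G.HasEdge x y G.κ ∧ ∀ k, (y k).mood = .discontent) ∨
      G.utility k (Function.update (profile x) k c) (noAttack M) = 1 ∧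
        G.HasEdge x (Function.update x k ⟨c, 1, .content⟩) G.κ := by
  set a := Function.update (profile x) k c
  have hsum := sum_deviationCost_update (G := G) hx hc
  have hk : ¬ Keeps (x k) (a k) := fun h => hc (by simpa [a] using h.2)
  have hne (i : Fin K) (hi : i ≠ k) : Keeps (x i) (a i) := ⟨hx i, by simp [a, hi, profile]⟩
  rcases (hG.utility_mem k a (noAttack M)).2.lt_or_eq with hu | hu
  · exact Or.inl ⟨_, hsum ▸ hG.hasEdge_discontent x a hG.q_pos hk hu, fun _ => rfl⟩
  · refine Or.inr ⟨hu, ?_⟩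
    convert hG.hasEdge_content x a hG.q_pos using 1
    · funext i
      by_cases hi : i = k
      · subst hi
        rw [if_neg hk, hu]
        simp [a]
      · rw [if_pos (hne i hi)]
        simp [a, hi, profile, ← hx i]
    · rw [Finset.sum_add_distrib, hsum, Finset.sum_eq_zero, add_zero]
      intro i _
      by_cases hi : i = k
      · subst hi
        rw [if_neg hk, hu, sub_self]
      · rw [if_pos (hne i hi)]

/-- Single experiments of cost κ suffice. An experiment that does not spread discontent has utility
1. Two players on distinct arms can force a collision, while a lone player who succeeds on the arm
of z has reached z. -/
theorem exists_path_of_content {R : State K M → State K M → Prop}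
    (hR : ∀ x y, (∀ k, (x k).mood = .content) → G.HasEdge x y G.κ → R x y) {z : State K M}
    (hz : ∀ k, (z k).mood = .content ∧ (z k).util = G.utility k (profile z) (noAttack M))
    {x : State K M} (hx : ∀ k, (x k).mood = .content) :
    ∃ y, Relation.ReflTransGen R x y ∧ (y = z ∨ ∀ k, (y k).mood = .discontent) := by
  have hupd {x : State K M} (hx : ∀ k, (x k).mood = .content) (i : Fin K) (c : Fin M) (k : Fin K) :
      (Function.update x i ⟨c, 1, .content⟩ k).mood = .content := by
    by_cases hk : k = i
    · subst hk; simp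
    · simp [hk, hx k]
  by_cases hK : ∃ i j : Fin K, i ≠ j
  · have key {x : State K M} (hx : ∀ k, (x k).mood = .content)
        (h : ∃ i j, (x i).act ≠ (x j).act) :
        ∃ y, Relation.ReflTransGen R x y ∧ (y = z ∨ ∀ k, (y k).mood = .discontent) := by
      obtain ⟨i, j, hij⟩ := h
      have hne : i ≠ j := fun h => hij (by rw [h])
      rcases hG.hasEdge_of_deviation hx hij.symm with ⟨y, hy, hD⟩ | ⟨hu, -⟩
      · exact ⟨y, .single (hR x y hx hy), Or.inr hD⟩
      · rw [utility_eq_zero hne (by simp [hne.symm, profile])] at hu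
        exact absurd hu zero_ne_one
    by_cases hconst : ∃ i j, (x i).act ≠ (x j).act
    · exact key hx hconst
    push Not at hconst
    obtain ⟨i, j, hij⟩ := hK
    obtain ⟨c, hc⟩ := hG.exists_ne i (x i).act
    rcases hG.hasEdge_of_deviation hx hc with ⟨y, hy, hD⟩ | ⟨-, hE⟩
    · exact ⟨y, .single (hR x y hx hy), Or.inr hD⟩
    · obtain ⟨y, hy, h⟩ := key (hupd hx i c) ⟨i, j, by simpa [hij.symm, hconst j i] using hc⟩
      exact ⟨y, .head (hR _ _ hx hE) hy, h⟩
  · push Not at hK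
    by_cases hk : ∃ k : Fin K, (x k).act ≠ (z k).act ∨ (x k).act = (z k).act
    swap
    · exact ⟨x, .refl, Or.inl (funext fun k => (hk ⟨k, ne_or_eq _ _⟩).elim)⟩
    obtain ⟨k, -⟩ := hk
    have key {x : State K M} (hx : ∀ k, (x k).mood = .content) (h : (z k).act ≠ (x k).act) :
        ∃ y, Relation.ReflTransGen R x y ∧ (y = z ∨ ∀ k, (y k).mood = .discontent) := by
      rcases hG.hasEdge_of_deviation hx h with ⟨y, hy, hD⟩ | ⟨hu, hE⟩
      · exact ⟨y, .single (hR x y hx hy), Or.inr hD⟩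
      · refine ⟨_, .single (hR _ _ hx hE), Or.inl (funext fun j => ?_)⟩
        obtain rfl := hK j k
        have hprof : Function.update (profile x) j (z j).act = profile z := funext fun i => by
          obtain rfl := hK i j
          simp [profile]
        rw [hprof, ← (hz j).2] at hu
        rw [Function.update_self]
        exact PlayerState.ext rfl hu.symm (hz j).1.symm
    -- On the arm of z the stored utility may be outdated, so the player leaves that arm first and
    -- returns by an experiment.
    by_cases h : (z k).act = (x k).act
    · obtain ⟨c, hc⟩ := hG.exists_ne k (x k).act
      rcases hG.hasEdge_of_deviation hx hc with ⟨y, hy, hD⟩ | ⟨-, hE⟩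
      · exact ⟨y, .single (hR x y hx hy), Or.inr hD⟩
      · obtain ⟨y, hy, h⟩ := key (hupd hx k c) (by simpa [h] using hc.symm)
        exact ⟨y, .head (hR _ _ hx hE) hy, h⟩
    · exact key hx h

theorem reflTransGen_of_resistance {r : State K M → ℝ} {z : State K M}
    (hz : ∀ k, (z k).mood = .content ∧ (z k).util = G.utility k (profile z) (noAttack M))
    (hr : ∀ x : State K M, (∀ k, (x k).mood = .content) → r x = G.κ)
    (hmixed : ∀ x : State K M, (∃ i, (x i).mood = .content) → (∃ j, (x j).mood = .discontent) →
      r x = 0)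
    (hD : ∀ x : State K M, (∃ _ : Fin K, True) → (∀ k, (x k).mood = .discontent) →
      Relation.ReflTransGen (fun x y => G.HasEdge x y (r x)) x z) (x : State K M) :
    Relation.ReflTransGen (fun x y => G.HasEdge x y (r x)) x z := by
  -- Without players a state is both all-content and all-discontent, so this case is split off.
  by_cases hK : ∃ _ : Fin K, True
  swap
  · have : x = z := funext fun k => (hK ⟨k, trivial⟩).elim
    rw [this]
  have hmood (m : Mood) : m ≠ .content ↔ m = .discontent := by cases m <;> simp
  by_cases hx : ∀ k, (x k).mood = .content
  · obtain ⟨y, hy, rfl | h⟩ := hG.exists_path_of_content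
      (R := fun x y => G.HasEdge x y (r x)) (fun x y hx h => by rwa [hr x hx]) hz hx
    · exact hy
    · exact hy.trans (hD y hK h)
  · push Not at hx
    obtain ⟨j, hj⟩ := hx
    by_cases hx' : ∀ k, (x k).mood = .discontent
    · exact hD x hK hx'
    · push Not at hx'
      obtain ⟨i, hi⟩ := hx'
      rw [hmood] at hj
      rw [Ne, ← hmood, not_not] at hi
      obtain ⟨y, hy, h⟩ := hG.hasEdge_of_mixed hi hj
      exact .head (by rwa [hmixed x ⟨i, hi⟩ ⟨j, hj⟩]) (hD y hK h)

/-- Discontent players choose their arms at order 0, and player k pays 1 - ū_k to become content. -/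
theorem hasEdge_root {x z : State K M} {w : Attack M} (hw : 0 < G.q w)
    (hz : ∀ k, (z k).mood = .content ∧ (z k).util = G.utility k (profile z) w)
    (hx : ∀ k, (x k).mood = .discontent) : G.HasEdge x z (K - ∑ k, (z k).util) := by
  have hkeep (k : Fin K) : ¬ Keeps (x k) (profile z k) := by simp [Keeps, hx k]
  convert hG.hasEdge_content x (profile z) hw using 1
  · funext k
    rw [if_neg (hkeep k)]
    exact PlayerState.ext rfl (hz k).2 (hz k).1
  · have h (k : Fin K) : (G.deviationCost x (profile z) k +
        if Keeps (x k) (profile z k) then 0 else 1 - G.utility k (profile z) w) =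
        1 - (z k).util := by
      rw [deviationCost_eq_zero fun h => by simp [hx k] at h, if_neg (hkeep k), (hz k).2,
        zero_add]
    rw [Finset.sum_congr rfl fun k _ => h k]
    simp

-- The resistance r x depends only on the state that is left. Any tree extracted from the paths to z
-- therefore has total resistance ∑ r x over x ≠ z, and no minimization over trees is needed.
open Classical in
theorem exists_resistance {z : G.Reach}
    (hz : ∀ k, (z.1 k).mood = .content ∧
      (z.1 k).util = G.utility k (profile z.1) (noAttack M)) :
    ∃ r : G.Reach → ℝ,
      ∑ x ∈ Finset.univ.erase z, r x =
        ∑ x ∈ Finset.univ.erase z, G.exitCost x.1 + (K - ∑ k, (z.1 k).util) ∧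
      ∀ x, Relation.ReflTransGen (fun x y : G.Reach => G.HasEdge x.1 y.1 (r x)) x z := by
  have lift {r : State K M → ℝ} (x : G.Reach) {y : State K M}
      (h : Relation.ReflTransGen (fun x y => G.HasEdge x y (r x)) x.1 y) :
      ∃ hy, Relation.ReflTransGen (fun x y : G.Reach => G.HasEdge x.1 y.1 (r x.1)) x
        ⟨y, hy⟩ := by
    induction h with
    | refl => exact ⟨x.2, .refl⟩
    | tail _ h ih =>
      obtain ⟨hy, ih⟩ := ih
      exact ⟨hG.enterable_of_hasEdge h hy, ih.tail h⟩
  have hexit (x : State K M) (j : Fin K) (hj : (x j).mood = .discontent) : G.exitCost x = 0 :=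
    if_neg fun h => by simp [h j] at hj
  by_cases hA : ∃ a, ∃ j, G.utility j a (noAttack M) < 1
  · obtain ⟨a, j, hj⟩ := hA
    let d : State K M := fun k => ⟨a k, G.utility k a (noAttack M), .discontent⟩
    have hdE (x : State K M) (hx : ∀ k, (x k).mood = .discontent) : G.HasEdge x d 0 := by
      have hkeep (k : Fin K) : ¬ Keeps (x k) (a k) := by simp [Keeps, hx k]
      convert hG.hasEdge_discontent x a hG.q_pos (hkeep j) hj using 1
      · funext k
        rw [if_neg (hkeep k)]
      · exact (Finset.sum_eq_zero fun k _ => deviationCost_eq_zero fun h => by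
          simp [hx k] at h).symm
    have hd : G.Enterable d := by
      obtain ⟨z₀, h₀⟩ := hG.exists_isInitial
      exact hG.enterable_of_hasEdge_of_isInitial (hdE z₀ fun k => (h₀ k).2) h₀
    have hdz : (⟨d, hd⟩ : G.Reach) ≠ z := by
      rintro rfl
      exact absurd (hz j).1 (by simp [d])
    -- All-discontent states are routed through the one hub d, so the jump to z is paid only once.
    let r : State K M → ℝ := fun x =>
      G.exitCost x + if x = d then K - ∑ k, (z.1 k).util else 0
    have hrd : r d = K - ∑ k, (z.1 k).util := by simp [r, hexit d j rfl]
    have hrne (x : State K M) (hx : x ≠ d) : r x = G.exitCost x := by simp [r, hx]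
    refine ⟨fun x => r x.1, ?_, fun x => (lift x (hG.reflTransGen_of_resistance hz ?_ ?_ ?_ _)).2⟩
    · simp only [r, Finset.sum_add_distrib]
      congr 1
      rw [Finset.sum_eq_single ⟨d, hd⟩]
      · simp
      · intro x _ hx
        exact if_neg fun h => hx (Subtype.ext h)
      · intro h
        simp [hdz] at h
    · intro x hx
      rw [hrne x (by rintro rfl; simpa [d] using hx j)]
      exact if_pos hx
    · rintro x ⟨i, hi⟩ ⟨k, hk⟩
      rw [hrne x (by rintro rfl; simp [d] at hi), hexit x k hk]
    · intro x _ hx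
      have hdz' : Relation.ReflTransGen (fun x y => G.HasEdge x y (r x)) d z.1 :=
        .single (by rw [hrd]; exact hG.hasEdge_root hG.q_pos hz fun _ => rfl)
      by_cases hxd : x = d
      · rwa [hxd]
      · exact .head (by rw [hrne x hxd, hexit x j (hx j)]; exact hdE x hx) hdz'
  -- If every no-attack utility is 1, no hub d need exist, but the jump to z is free and every
  -- all-discontent state can take it.
  · push Not at hA
    have hu (k : Fin K) : (z.1 k).util = 1 := by
      rw [(hz k).2]
      exact (hG.utility_mem _ _ _).2.antisymm (hA _ k)
    have hW : (K : ℝ) - ∑ k, (z.1 k).util = 0 := by simp [hu]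
    refine ⟨fun x => G.exitCost x.1, by rw [hW, add_zero], fun x =>
      (lift (r := G.exitCost) x (hG.reflTransGen_of_resistance (r := G.exitCost) hz
        (fun x hx => if_pos hx) ?_ ?_ _)).2⟩
    · rintro x - ⟨k, hk⟩
      exact hexit x k hk
    · rintro x ⟨j, -⟩ hx
      refine .single ?_
      rw [hexit x j (hx j), ← hW]
      exact hG.hasEdge_root hG.q_pos hz hx

/-! ### Stochastic stability -/

theorem stable_of_maximal {z : G.Reach}
    (hz : ∀ k, (z.1 k).mood = .content ∧
      (z.1 k).util = G.utility k (profile z.1) (noAttack M))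
    (hmax : ∀ a : Fin K → Fin M, ∑ k, G.utility k a (noAttack M) ≤ ∑ k, (z.1 k).util) :
    IsStochasticallyStable G.chain z ∧
      ∀ y : G.Reach, (∀ k, (y.1 k).mood = .content) →
        ∑ k, (y.1 k).util < ∑ k, (z.1 k).util → ¬ IsStochasticallyStable G.chain y := by
  classical
  have := hG.nonempty_reach
  obtain ⟨r, hsum, hpath⟩ := hG.exists_resistance hz
  obtain ⟨f, hfz, hf, hE⟩ := exists_tree_of_reflTransGen hpath
  have : Nonempty (Draw K M) := ⟨noAttack M, fun _ => ⟨0, (Nat.zero_le K).trans_lt hG.lt⟩,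
    fun _ => .content, fun _ => .content⟩
  choose! o ho₁ ho₂ using hE
  obtain ⟨c, hc, hlow⟩ := (HasLeadingOrder.prod (t := Finset.univ.erase z) fun x hx =>
    ho₂ x (Finset.ne_of_mem_erase hx)).exists_le
  obtain ⟨C, hC, hup⟩ := hG.treeWeight_chain_le
  obtain ⟨s, hs⟩ := hG.exists_shortfall_eq_zero
  have hexit (x : G.Reach) (hx : ∀ k, (x.1 k).mood = .content) : G.exitCost x.1 = G.κ :=
    if_pos hx
  have herase (x : G.Reach) : ∑ y ∈ Finset.univ.erase x, G.exitCost y.1 =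
      ∑ y : G.Reach, G.exitCost y.1 - G.exitCost x.1 :=
    Finset.sum_erase_eq_sub (f := fun y : G.Reach => G.exitCost y.1) (Finset.mem_univ x)
  have hstable := stable_of_treeWeight_bounds hG.isRegularPerturbation
    (fun x y => hG.isPowerLike_transition x.1 y.1) hc (s := z) (C := C)
    (r := ∑ x ∈ Finset.univ.erase z, r x) (fun y ε hε => ?_) ?_
  · refine ⟨hstable.1, fun y hy hlt => hstable.2 y _ C ?_ (hup s y)⟩
    rw [hsum, herase, herase, hexit z fun k => (hz k).1, hexit y hy, hs, shortfall_of_content hy]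
    linarith
  -- For an all-content root y, the reference state of shortfall 0 reduces the claim to maximality
  -- of z. For any other root the potential is dropped by taking s = y, and κ > K suffices.
  · have hexp : ∃ s : G.Reach, ∑ x ∈ Finset.univ.erase z, r x ≤
        ∑ x ∈ Finset.univ.erase y, G.exitCost x.1 + (shortfall y.1 - shortfall s.1) := by
      rw [hsum, herase, herase, hexit z fun k => (hz k).1]
      by_cases hy : ∀ k, (y.1 k).mood = .content
      · refine ⟨s, ?_⟩
        rw [hexit y hy, hs, shortfall_of_content hy]
        linarith [hG.sum_util_le y.2 hmax]
      · refine ⟨y, ?_⟩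
        rw [show G.exitCost y.1 = 0 from if_neg hy]
        have h₁ : 0 ≤ ∑ k, (z.1 k).util := Finset.sum_nonneg fun k _ =>
          ((hG.invariant_of_enterable z.2).1 k).1
        have h₂ : (K : ℝ) < M := by exact_mod_cast hG.lt
        linarith [hG.κ_gt]
    obtain ⟨s, hs⟩ := hexp
    exact (hup s y ε hε).trans (mul_le_mul_of_nonneg_left
      (Real.rpow_le_rpow_of_exponent_ge hε.1 hε.2.le hs) hC)
  · filter_upwards [hlow, eventually_mem_Ioo] with ε h hε
    -- One tree with one draw per edge already gives a lower bound of the optimal order.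
    refine h.trans (le_trans ?_ (prod_le_treeWeight (hG.isStochastic_chain hε).1
      (mem_inTrees.mpr ⟨hfz, hf⟩)))
    refine Finset.prod_le_prod (fun x _ => (hG.isPowerLike_weight _ _).nonneg hε) fun x hx => ?_
    have h := hG.weight_le_transition hε x.1 (o x)
    rwa [ho₁ x (Finset.ne_of_mem_erase hx)] at h

theorem stable_iff {z : State K M} (hz : z ∈ G.ContentAligned) :
    G.Stable z ↔
      (∀ k, (z k).mood = .content) ∧
      (∀ k, (z k).util = G.utility k (profile z) (noAttack M)) ∧
      ∀ (a : Fin K → Fin M) (w : Attack M),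
        ∑ k, G.utility k a w ≤ ∑ k, G.utility k (profile z) (noAttack M) := by
  obtain ⟨w, hw⟩ := hz
  constructor
  · rintro ⟨h, hst⟩
    have : Nonempty (Fin M) := ⟨⟨0, (Nat.zero_le K).trans_lt hG.lt⟩⟩
    obtain ⟨b, hb⟩ := Finite.exists_max fun a : Fin K → Fin M =>
      ∑ k, G.utility k a (noAttack M)
    let y : State K M := fun k => ⟨b k, G.utility k b (noAttack M), .content⟩
    have hy : ∀ k, (y k).mood = .content ∧
      (y k).util = G.utility k (profile y) (noAttack M) := fun k => ⟨rfl, rfl⟩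
    have hle : ∑ k, G.utility k b (noAttack M) ≤ ∑ k, (z k).util := by
      by_contra! hlt
      exact (hG.stable_of_maximal (z := ⟨y, hG.enterable_of_aligned hG.q_pos hy⟩) hy hb).2
        ⟨z, h⟩ (fun k => (hw k).1) hlt hst
    have hutil (k : Fin K) : (z k).util ≤ G.utility k (profile z) (noAttack M) := by
      rw [(hw k).2]
      exact hG.utility_le_noAttack _ _ _
    -- The total utility of z lies between the maximal welfare and the no-attack welfare of its
    -- profile, so all termwise inequalities are equalities.
    have heq := (Finset.sum_eq_sum_iff_of_le fun k (_ : k ∈ Finset.univ) => hutil k).mp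
      ((Finset.sum_le_sum fun k _ => hutil k).antisymm ((hb _).trans hle))
    refine ⟨fun k => (hw k).1, fun k => heq k (Finset.mem_univ k), fun a v => ?_⟩
    calc ∑ k, G.utility k a v ≤ ∑ k, G.utility k a (noAttack M) :=
          Finset.sum_le_sum fun k _ => hG.utility_le_noAttack k a v
      _ ≤ ∑ k, G.utility k b (noAttack M) := hb a
      _ ≤ ∑ k, (z k).util := hle
      _ ≤ _ := Finset.sum_le_sum fun k _ => hutil k
  · rintro ⟨hc, hu, hmax⟩
    have hz : ∀ k, (z k).mood = .content ∧ (z k).util = G.utility k (profile z) (noAttack M) :=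
      fun k => ⟨hc k, hu k⟩
    refine ⟨hG.enterable_of_aligned hG.q_pos hz,
      (hG.stable_of_maximal (z := ⟨z, _⟩) hz fun a => ?_).1⟩
    rw [Finset.sum_congr rfl fun k _ => hu k]
    exact hmax a _

end IsAdmissible

end Game

end MatchingPhase

theorem mainTheorem2 {K M : ℕ} (hKM : K < M) (G : MatchingPhase.Game K M)
    (hκ : (M : ℝ) < G.κ) (hβ0 : 0 < G.β) (hβκ : G.β < G.κ)
    (hest : ∀ k m, G.est k m ∈ Set.Icc (0 : ℝ) 1)
    (hq_nonneg : ∀ w, 0 ≤ G.q w) (hq_sum : ∑ w, G.q w = 1)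
    (hq_pos : 0 < G.q (MatchingPhase.noAttack M)) :
    PerturbedChain.IsRegularPerturbation (G.chain 0) G.chain ∧
    (∃ μ0, PerturbedChain.IsLimitDistribution G.chain μ0 ∧
      PerturbedChain.IsStationary (G.chain 0) μ0) ∧
    ∀ z ∈ G.ContentAligned,
      G.Stable z ↔
        (∀ k, (z k).mood = MatchingPhase.Mood.content) ∧
        (∀ k, (z k).util =
          G.utility k (MatchingPhase.Game.profile z) (MatchingPhase.noAttack M)) ∧
        ∀ (a : Fin K → Fin M) (w : MatchingPhase.Attack M),
          ∑ k, G.utility k a w ≤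
            ∑ k, G.utility k (MatchingPhase.Game.profile z) (MatchingPhase.noAttack M) := by
  have hG : G.IsAdmissible := ⟨hKM, hκ, hβ0, hest, hq_nonneg, hq_sum, hq_pos⟩
  have := hG.nonempty_reach
  classical
  obtain ⟨μ0, h₁, h₂, -⟩ := PerturbedChain.exists_tendsto_treeWeight hG.isRegularPerturbation
    fun x y => hG.isPowerLike_transition x.1 y.1
  exact ⟨hG.isRegularPerturbation, ⟨μ0, h₁, h₂⟩, fun z hz => hG.stable_iff hz⟩
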